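/- A partition of a nonnegative integer is $23$-regular if none of its parts is divisible by $23$; let $b_{23}(n)$ denote the number of $23$-regular partitions of $n$ (so $b_{23}(0)=1$). For $k\ge 0$ let $$a(k)=\Big(\tfrac12-\tfrac{\sqrt{15}}{15}\Big)\big(2+\sqrt{15}\big)^k+\Big(\tfrac12+\tfrac{\sqrt{15}}{15}\Big)\big(2-\sqrt{15}\big)^k .$$ These numbers are integers, and $a(k+1)=4a(k)+11a(k-1)$ for all $k\ge 1$. For all integers $n\ge 0$ and $k\ge 0$, $$b_{23}\Big(5^{24k}n+\tfrac{11}{12}\big(5^{24k}-1\big)\Big)\equiv a(12k)\,b_{23}(n)\pmod{23},$$ and for all integers $n\ge 0$, $k\ge 0$ and every $r\in\{0,1,2,3\}$, $$b_{23}\Big(5^{24k+24}n+\tfrac{1}{12}\big(5^{24k+23}(12r+7)-11\big)\Big)\equiv 0\pmod{23}.$$ -/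

import Mathlib

/-- `regularPartitionCount l n` is the number `b_l(n)` of `l`-regular partitions of `n`, that is, of
partitions of `n` none of whose parts is divisible by `l`. -/
def regularPartitionCount (l n : ℕ) : ℕ :=
  (Nat.Partition.restricted n (fun i => ¬ l ∣ i)).card

/-- The sequence `a(k)`, given by its closed form over the reals. -/
noncomputable def aSeq (k : ℕ) : ℝ :=
  (1 / 2 - Real.sqrt 15 / 15) * (2 + Real.sqrt 15) ^ k +
    (1 / 2 + Real.sqrt 15 / 15) * (2 - Real.sqrt 15) ^ k

/-! Write P for Euler's product ∏ (1 - X^n). In characteristic 23, Frobenius turns ∏ (1 - X^(23n))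
into P^23, so the generating function of b_23 becomes P^22. Reading n as the exponent 12n + 11 of
η(12z)^22, multiplication by 25 is the map m ↦ 25m + 22, whose orbits give the arguments in the
theorem.

The core is `sec_sec_sec_pentagonalSeries_pow`, a Hecke relation at 5: for m ≡ 2 mod 5, b(25m + 22)
≡ 4 b(m) + 11 b((m - 22)/25), the last term being present only when m ≡ 22 mod 25. Hence the
residues along an orbit satisfy w(j+2) = 4w(j+1) + 11w(j). Twelve steps of this recurrence multiply
by 14 modulo 23, for a(k) as well, which gives the first congruence. If the orbit starts at m ≡ 2
mod 5 with m ≢ 22 mod 25, then w(1) = 4w(0), which forces w(11) = 0 and gives the second.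

The Hecke relation is obtained by power series alone. The 5-dissection P = A(X^5) - X P(X^25) + X^2
Q(X^5) satisfies AQ = -P(X^5)^2, by a sign-reversing reflection on integral points of a circle. So P
is a root of an explicit quintic over the series in X^5, with norm D, and D P(X^5) = P^6. The
quintic expresses the section of P^e at e mod 5 through D, P(X^5) and X; replacing D by P^6 / P(X^5)
makes the section operators iterable. -/

open PowerSeries

/-! ### Splitting series by exponents modulo 5. -/

namespace PowerSeries

section Section
variable {R : Type*} [CommRing R]

/-- The series formed by the coefficients of `f` at the exponents `5 * n + r`. -/
noncomputable def sec (r : ℕ) : R⟦X⟧ →ₗ[R] R⟦X⟧ where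
  toFun f := mk fun n ↦ coeff (5 * n + r) f
  map_add' f g := by ext; simp
  map_smul' c f := by ext; simp

theorem coeff_sec (r n : ℕ) (f : R⟦X⟧) : coeff n (sec r f) = coeff (5 * n + r) f := by
  simp [sec]

/-- The substitution `X ↦ X ^ 5`. -/
noncomputable abbrev expand5 : R⟦X⟧ →ₐ[R] R⟦X⟧ := expand 5 (by norm_num)

theorem sec_X_pow_mul_expand5 {r k : ℕ} (hr : r < 5) (hk : k < 5) (u : R⟦X⟧) :
    sec r (X ^ k * expand5 u) = if r = k then u else 0 := by
  ext n
  rw [coeff_sec, coeff_X_pow_mul', coeff_expand]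
  by_cases h : r = k
  · subst h
    simp
  · rw [if_neg h, map_zero]
    split_ifs
    · omega
    · rfl
    · rfl

theorem ext_sec {f g : R⟦X⟧} (h : ∀ r < 5, sec r f = sec r g) : f = g := by
  ext n
  have := congrArg (coeff (n / 5)) (h (n % 5) (Nat.mod_lt _ (by norm_num)))
  rwa [coeff_sec, coeff_sec, Nat.div_add_mod] at this

theorem sum_X_pow_mul_expand5_sec (f : R⟦X⟧) :
    f = ∑ k ∈ Finset.range 5, X ^ k * expand5 (sec k f) := by
  refine ext_sec fun r hr ↦ ?_
  rw [map_sum, Finset.sum_congr rfl fun k hk ↦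
    sec_X_pow_mul_expand5 hr (Finset.mem_range.mp hk) (sec k f)]
  simp [hr]

theorem sec_add_X_pow_mul (r k : ℕ) (f : R⟦X⟧) : sec (r + k) (X ^ k * f) = sec r f := by
  ext n
  rw [coeff_sec, coeff_sec, ← add_assoc, coeff_X_pow_mul]

theorem sec_X_pow_mul_of_lt {r k : ℕ} (h : r < k) (hk : k ≤ r + 5) (f : R⟦X⟧) :
    sec r (X ^ k * f) = X * sec (r + 5 - k) f := by
  ext n
  rw [coeff_sec, coeff_X_pow_mul']
  rcases n with _ | n
  · simp [h]
  · rw [if_pos (by omega), coeff_succ_X_mul, coeff_sec,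
      show 5 * (n + 1) + r - k = 5 * n + (r + 5 - k) by omega]

/-- Sections are linear over the subring of series in X^5. -/
theorem sec_expand5_mul {r : ℕ} (hr : r < 5) (u f : R⟦X⟧) :
    sec r (expand5 u * f) = u * sec r f := by
  have h : expand5 u * f = ∑ k ∈ Finset.range 5, X ^ k * expand5 (u * sec k f) := by
    conv_lhs => rw [sum_X_pow_mul_expand5_sec f, Finset.mul_sum]
    refine Finset.sum_congr rfl fun k _ ↦ ?_
    rw [map_mul]
    ring
  rw [h, map_sum, Finset.sum_congr rfl fun k hk ↦
    sec_X_pow_mul_expand5 hr (Finset.mem_range.mp hk) (u * sec k f)]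
  simp [hr]

end Section

/-! ### Pentagonal numbers modulo 5 and the dissection of P. -/

section Pentagonal
variable (R : Type*) [CommRing R]

/-- Since 24 `pentagonal k` + 1 = (6k - 1)^2, this is the square of 6(5m + 1) - 1 = -5(6(-m) - 1).
-/
theorem pentagonal_five_mul_add_one (m : ℤ) :
    pentagonal (5 * m + 1) = 25 * pentagonal (-m) + 1 := by
  have h1 := two_mul_natCast_pentagonal (5 * m + 1)
  have h2 := two_mul_natCast_pentagonal_neg m
  zify
  linarith

theorem pentagonal_mod_five (k : ℤ) :
    pentagonal k % 5 = 0 ∧ (k % 5 = 0 ∨ k % 5 = 2) ∨ pentagonal k % 5 = 1 ∧ k % 5 = 1 ∨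
      pentagonal k % 5 = 2 ∧ (k % 5 = 3 ∨ k % 5 = 4) := by
  have h1 := two_mul_natCast_pentagonal k
  have h2 : (2 * (pentagonal k : ℤ)) % 5 = ((k % 5) * (3 * (k % 5) - 1)) % 5 := by
    rw [h1]; simp [Int.mul_emod, Int.sub_emod]
  have h3 : 0 ≤ k % 5 := by omega
  have h4 : k % 5 < 5 := by omega
  interval_cases h : k % 5 <;> omega

theorem sec_pentagonalSeries_of_three_le {r : ℕ} (hr : 3 ≤ r) (hr' : r < 5) :
    sec r (pentagonalSeries R) = 0 := by
  ext n
  rw [coeff_sec, map_zero, coeff_pentagonalSeries_eq_zero]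
  rintro ⟨k, hk⟩
  have := pentagonal_mod_five k
  omega

theorem sec_one_pentagonalSeries :
    sec 1 (pentagonalSeries R) = -expand5 (pentagonalSeries R) := by
  ext n
  rw [coeff_sec, map_neg, coeff_expand]
  by_cases h : 5 * n + 1 ∈ Set.range pentagonal
  · obtain ⟨k, hk⟩ := h
    have := pentagonal_mod_five k
    obtain ⟨m, rfl⟩ : ∃ m, k = 5 * m + 1 := ⟨k / 5, by omega⟩
    rw [← hk, coeff_pentagonalSeries_pentagonal]
    rw [pentagonal_five_mul_add_one] at hk
    rw [if_pos (by omega), show n / 5 = pentagonal (-m) by omega,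
      coeff_pentagonalSeries_pentagonal, Int.negOnePow_succ, Int.negOnePow_neg,
      show 5 * m = m + 2 * (2 * m) by ring, Int.negOnePow_add, Int.negOnePow_two_mul]
    simp
  · rw [coeff_pentagonalSeries_eq_zero R h]
    split_ifs with hd
    · obtain ⟨m, rfl⟩ := hd
      rw [coeff_pentagonalSeries_eq_zero R, neg_zero]
      rintro ⟨k, hk⟩
      refine h ⟨5 * (-k) + 1, ?_⟩
      rw [pentagonal_five_mul_add_one, neg_neg]
      omega
    · simp

/-- Euler's function split according to the residues of the exponents modulo `5`. -/
theorem pentagonalSeries_eq_dissection :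
    pentagonalSeries R = expand5 (sec 0 (pentagonalSeries R)) -
      X * expand5 (expand5 (pentagonalSeries R)) +
      X ^ 2 * expand5 (sec 2 (pentagonalSeries R)) := by
  conv_lhs => rw [sum_X_pow_mul_expand5_sec (pentagonalSeries R)]
  simp [Finset.sum_range_succ, sec_one_pentagonalSeries, sub_eq_add_neg,
    sec_pentagonalSeries_of_three_le]

end Pentagonal
end PowerSeries

/-! ### The character modulo 12 and the signs in Euler's pentagonal theorem. -/

section Character

/-- The even quadratic character modulo `12`. -/
def chiTwelve (x : ZMod 12) : ℤ :=
  if x = 1 ∨ x = 11 then 1 else if x = 5 ∨ x = 7 then -1 else 0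

theorem chiTwelve_neg (x : ZMod 12) : chiTwelve (-x) = chiTwelve x := by
  revert x; decide

/-- This is the rational reflection (x, y) ↦ ((3x - 4y)/5, (-4x - 3y)/5) read modulo 12, where 1/5 =
5. -/
theorem chiTwelve_reflection (x y : ZMod 12) :
    chiTwelve (3 * x + 4 * y) * chiTwelve (4 * x - 3 * y) = -(chiTwelve x * chiTwelve y) := by
  revert x y; decide

theorem emod_six_of_chiTwelve_ne_zero {x : ℤ} (h : chiTwelve x ≠ 0) :
    x % 6 = 1 ∨ x % 6 = 5 := by
  have h1 : (x : ZMod 12) = ((x % 12 : ℤ) : ZMod 12) := by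
    rw [ZMod.intCast_eq_intCast_iff]; exact (Int.mod_modEq x 12).symm
  rw [h1] at h
  have h2 : 0 ≤ x % 12 := by omega
  have h3 : x % 12 < 12 := by omega
  generalize hr : x % 12 = r at *
  interval_cases r <;> first | omega | exact absurd (by decide) h

theorem sq_emod_of_chiTwelve_ne_zero {x : ℤ} (h : chiTwelve x ≠ 0) : x ^ 2 % 24 = 1 := by
  have h1 := emod_six_of_chiTwelve_ne_zero h
  have h2 : x % 24 = 1 ∨ x % 24 = 5 ∨ x % 24 = 7 ∨ x % 24 = 11 ∨ x % 24 = 13 ∨ x % 24 = 17 ∨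
    x % 24 = 19 ∨ x % 24 = 23 := by omega
  rcases h2 with h | h | h | h | h | h | h | h <;> simp [pow_two, Int.mul_emod, h]

theorem chiTwelve_six_mul_sub_one (k : ℤ) :
    chiTwelve ((6 * k - 1 : ℤ) : ZMod 12) = Int.negOnePow k := by
  rcases Int.even_or_odd' k with ⟨m, rfl | rfl⟩
  · rw [Int.negOnePow_two_mul, show 6 * (2 * m) - 1 = 12 * m - 1 by ring]
    push_cast
    rw [show (12 : ZMod 12) = 0 by decide]
    simp only [zero_mul, zero_sub]
    decide
  · rw [Int.negOnePow_two_mul_add_one, show 6 * (2 * m + 1) - 1 = 12 * m + 5 by ring]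
    push_cast
    rw [show (12 : ZMod 12) = 0 by decide]
    simp only [zero_mul, zero_add]
    decide

theorem six_mul_sub_one_sq (k : ℤ) : (6 * k - 1) ^ 2 = 24 * (pentagonal k : ℤ) + 1 := by
  linear_combination -12 * two_mul_natCast_pentagonal k

/-- The square roots of `24 * n + 1` in an interval, weighted by the character modulo `12`,
count the representation of `n` as a pentagonal number. -/
theorem sum_chiTwelve_sq_eq {n : ℕ} {B : ℤ} (hB : 24 * (n : ℤ) + 1 ≤ B) :
    ∑ x ∈ (Finset.Icc (-B) B).filter (fun x ↦ x ^ 2 = 24 * (n : ℤ) + 1), chiTwelve (x : ZMod 12) =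
      2 * coeff n (pentagonalSeries ℤ) := by
  by_cases h : n ∈ Set.range pentagonal
  · obtain ⟨k, rfl⟩ := h
    have hs : (Finset.Icc (-B) B).filter (fun x ↦ x ^ 2 = 24 * (pentagonal k : ℤ) + 1) =
        {6 * k - 1, -(6 * k - 1)} := by
      ext x
      rw [← six_mul_sub_one_sq, Finset.mem_filter, sq_eq_sq_iff_eq_or_eq_neg, Finset.mem_Icc,
        Finset.mem_insert, Finset.mem_singleton, and_iff_right_iff_imp]
      rw [← six_mul_sub_one_sq] at hB
      rintro (rfl | rfl) <;> constructor <;> nlinarith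
    rw [hs, Finset.sum_pair (by omega), Int.cast_neg, chiTwelve_neg, chiTwelve_six_mul_sub_one,
      coeff_pentagonalSeries_pentagonal]
    rw [two_mul, Int.cast_id]
  · rw [coeff_pentagonalSeries_eq_zero ℤ h, mul_zero]
    refine Finset.sum_eq_zero fun x hx ↦ ?_
    by_contra h0
    refine h ?_
    have hx := (Finset.mem_filter.mp hx).2
    rcases emod_six_of_chiTwelve_ne_zero h0 with h1 | h1
    · refine ⟨-(x / 6), ?_⟩
      have := six_mul_sub_one_sq (-(x / 6))
      rw [show 6 * -(x / 6) - 1 = -x by omega, neg_sq, hx] at this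
      omega
    · refine ⟨x / 6 + 1, ?_⟩
      have := six_mul_sub_one_sq (x / 6 + 1)
      rw [show 6 * (x / 6 + 1) - 1 = x by omega, hx] at this
      omega

end Character

/-! ### A sign-reversing reflection on the circle. -/

section Circle

/-- The integral points on the circle `x ^ 2 + y ^ 2 = 24 * N + 2` at which neither coordinate is
killed by the character. -/
noncomputable def circlePoints (N : ℕ) : Finset (ℤ × ℤ) :=
  (Finset.Icc (-(24 * N + 2 : ℤ)) (24 * N + 2) ×ˢ Finset.Icc (-(24 * N + 2 : ℤ)) (24 * N + 2)).filter
    fun p ↦ p.1 ^ 2 + p.2 ^ 2 = 24 * N + 2 ∧ chiTwelve p.1 * chiTwelve p.2 ≠ 0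

theorem mem_circlePoints {N : ℕ} {p : ℤ × ℤ} : p ∈ circlePoints N ↔
    p.1 ^ 2 + p.2 ^ 2 = 24 * N + 2 ∧ chiTwelve p.1 * chiTwelve p.2 ≠ 0 := by
  rw [circlePoints, Finset.mem_filter, and_iff_right_iff_imp]
  rintro ⟨h, -⟩
  simp only [Finset.mem_product, Finset.mem_Icc]
  refine ⟨⟨?_, ?_⟩, ?_, ?_⟩ <;> nlinarith [sq_nonneg p.1, sq_nonneg p.2]

theorem chiTwelve_mul_reflection {x y x' y' : ℤ} (hx : 5 * x' = 3 * x - 4 * y)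
    (hy : 5 * y' = -4 * x - 3 * y) :
    chiTwelve x' * chiTwelve y' = -(chiTwelve x * chiTwelve y) := by
  have hx' : (x' : ZMod 12) = 3 * x + 4 * y := by
    have := congrArg (fun z : ℤ ↦ 5 * (z : ZMod 12)) hx
    push_cast at this
    have h12 : (12 : ZMod 12) = 0 := by decide
    linear_combination this + (-2 * x' + x - 2 * y) * h12
  have hy' : (y' : ZMod 12) = 4 * x - 3 * y := by
    have := congrArg (fun z : ℤ ↦ 5 * (z : ZMod 12)) hy
    push_cast at this
    have h12 : (12 : ZMod 12) = 0 := by decide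
    linear_combination this + (-2 * y' - 2 * x - y) * h12
  rw [hx', hy', chiTwelve_reflection]

/-- The reflection ((3x - 4y)/5, (-4x - 3y)/5) is integral when y ≡ 2x mod 5, keeps x^2 + y^2 and 2x
- y, and negates the character product, so the terms cancel in pairs. A fixed point would have x =
-2y even, where the character vanishes. -/
theorem sum_circlePoints_of_dvd_sub (N : ℕ) :
    ∑ p ∈ circlePoints N with 5 ∣ 2 * p.1 - p.2, chiTwelve p.1 * chiTwelve p.2 = 0 := by
  have key (p : ℤ × ℤ) (hp : 5 ∣ 2 * p.1 - p.2) :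
      5 * ((3 * p.1 - 4 * p.2) / 5) = 3 * p.1 - 4 * p.2 ∧
      5 * ((-4 * p.1 - 3 * p.2) / 5) = -4 * p.1 - 3 * p.2 := by omega
  refine Finset.sum_involution
    (fun p _ ↦ ((3 * p.1 - 4 * p.2) / 5, (-4 * p.1 - 3 * p.2) / 5)) ?_ ?_ ?_ ?_
  · intro p hp
    obtain ⟨h1, h2⟩ := key p (Finset.mem_filter.mp hp).2
    rw [chiTwelve_mul_reflection h1 h2, add_neg_cancel]
  · intro p hp h0 h
    obtain ⟨h1, h2⟩ := key p (Finset.mem_filter.mp hp).2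
    have h3 := congrArg Prod.fst h
    have h4 := emod_six_of_chiTwelve_ne_zero (left_ne_zero_of_mul h0)
    simp only at h3
    omega
  · intro p hp
    obtain ⟨hp, hd⟩ := Finset.mem_filter.mp hp
    obtain ⟨h1, h2⟩ := key p hd
    rw [mem_circlePoints] at hp
    rw [Finset.mem_filter, mem_circlePoints, chiTwelve_mul_reflection h1 h2]
    refine ⟨⟨?_, neg_ne_zero.mpr hp.2⟩, ?_⟩
    · rw [← hp.1]
      dsimp only
      generalize (3 * p.1 - 4 * p.2) / 5 = x' at *
      generalize (-4 * p.1 - 3 * p.2) / 5 = y' at *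
      have : 25 * (x' ^ 2 + y' ^ 2) = 25 * (p.1 ^ 2 + p.2 ^ 2) := by
        linear_combination (5 * x' + (3 * p.1 - 4 * p.2)) * h1 +
          (5 * y' + (-4 * p.1 - 3 * p.2)) * h2
      linarith
    · dsimp only
      omega
  · intro p hp
    obtain ⟨h1, h2⟩ := key p (Finset.mem_filter.mp hp).2
    ext <;> dsimp only <;> omega

theorem sum_circlePoints_of_dvd_add (N : ℕ) :
    ∑ p ∈ circlePoints N with 5 ∣ 2 * p.1 + p.2, chiTwelve p.1 * chiTwelve p.2 = 0 := by
  rw [← sum_circlePoints_of_dvd_sub N]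
  refine Finset.sum_equiv ((Equiv.refl ℤ).prodCongr (Equiv.neg ℤ)) (fun p ↦ ?_) fun p _ ↦ ?_
  · simp [mem_circlePoints, chiTwelve_neg]
  · simp [chiTwelve_neg]

/-- The number of the two conditions `y = 2 * x`, `y = -2 * x` modulo `5` that hold at a point with
`x ^ 2 = 24 * i + 1` and `y ^ 2 = 24 * j + 1`. -/
def residueWeight (i j : ℕ) : ℤ :=
  if i % 5 = 1 ∧ j % 5 = 1 then 2 else if i % 5 = 3 ∨ i % 5 = 4 ∨ j % 5 = 3 ∨ j % 5 = 4 then 0 else 1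

/-- Here x^2 + y^2 ≡ 0 mod 5, so y ≡ ±2x, and both signs occur exactly when x ≡ y ≡ 0, that is i ≡ j
≡ 1. Residues 3 and 4 make 24i + 1 a non-square modulo 5, so the weight 0 is never attained here. -/
theorem residueWeight_eq {i j : ℕ} {x y : ℤ} (hx : x ^ 2 = 24 * i + 1) (hy : y ^ 2 = 24 * j + 1)
    (hij : (i + j) % 5 = 2) :
    (if 5 ∣ 2 * x - y then 1 else 0) + (if 5 ∣ 2 * x + y then 1 else 0) = residueWeight i j := by
  have h1 : ((x % 5) * (x % 5)) % 5 = (24 * i + 1) % 5 := by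
    rw [← hx, pow_two, ← Int.mul_emod]
  have h2 : ((y % 5) * (y % 5)) % 5 = (24 * j + 1) % 5 := by
    rw [← hy, pow_two, ← Int.mul_emod]
  have e1 : (2 * x - y) % 5 = (2 * (x % 5) - y % 5) % 5 := by omega
  have e2 : (2 * x + y) % 5 = (2 * (x % 5) + y % 5) % 5 := by omega
  have hx0 : 0 ≤ x % 5 := by omega
  have hx5 : x % 5 < 5 := by omega
  have hy0 : 0 ≤ y % 5 := by omega
  have hy5 : y % 5 < 5 := by omega
  simp only [Int.dvd_iff_emod_eq_zero, e1, e2, residueWeight]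
  generalize x % 5 = u at *
  generalize y % 5 = v at *
  interval_cases u <;> interval_cases v <;> norm_num at h1 h2 ⊢ <;> split_ifs <;> first | rfl | omega

theorem sum_antidiagonal_residueWeight {N : ℕ} (hN : N % 5 = 2) :
    ∑ p ∈ Finset.HasAntidiagonal.antidiagonal N, residueWeight p.1 p.2 *
      (coeff p.1 (pentagonalSeries ℤ) * coeff p.2 (pentagonalSeries ℤ)) = 0 := by
  have hmaps (q : ℤ × ℤ) (hq : q ∈ circlePoints N) :
      (q.1 ^ 2 / 24).toNat + (q.2 ^ 2 / 24).toNat = N ∧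
        q.1 ^ 2 = 24 * ((q.1 ^ 2 / 24).toNat : ℤ) + 1 ∧
        q.2 ^ 2 = 24 * ((q.2 ^ 2 / 24).toNat : ℤ) + 1 := by
    rw [mem_circlePoints] at hq
    have h1 := sq_emod_of_chiTwelve_ne_zero (left_ne_zero_of_mul hq.2)
    have h2 := sq_emod_of_chiTwelve_ne_zero (right_ne_zero_of_mul hq.2)
    have h3 := sq_nonneg q.1
    have h4 := sq_nonneg q.2
    omega
  have h1 := sum_circlePoints_of_dvd_sub N
  have h2 := sum_circlePoints_of_dvd_add N
  rw [Finset.sum_filter] at h1 h2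
  have h3 : ∑ q ∈ circlePoints N, residueWeight (q.1 ^ 2 / 24).toNat (q.2 ^ 2 / 24).toNat *
      (chiTwelve q.1 * chiTwelve q.2) = 0 := by
    rw [← add_zero (0 : ℤ)]
    refine Eq.trans ?_ (congrArg₂ (· + ·) h1 h2)
    rw [← Finset.sum_add_distrib]
    refine Finset.sum_congr rfl fun q hq ↦ ?_
    obtain ⟨e1, e2, e3⟩ := hmaps q hq
    rw [← residueWeight_eq e2 e3 (by omega)]
    split_ifs <;> ring
  rw [← Finset.sum_fiberwise_of_maps_to
    (g := fun q : ℤ × ℤ ↦ ((q.1 ^ 2 / 24).toNat, (q.2 ^ 2 / 24).toNat))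
    (t := Finset.HasAntidiagonal.antidiagonal N)
    (fun q hq ↦ Finset.HasAntidiagonal.mem_antidiagonal.mpr (hmaps q hq).1)] at h3
  -- The factor 4 counts the sign choices of x and y above each pair (i, j).
  have h4 : 4 * ∑ p ∈ Finset.HasAntidiagonal.antidiagonal N, residueWeight p.1 p.2 *
      (coeff p.1 (pentagonalSeries ℤ) * coeff p.2 (pentagonalSeries ℤ)) = 0 := by
    rw [← h3, Finset.mul_sum]
    refine Finset.sum_congr rfl fun p hp ↦ ?_
    rw [Finset.HasAntidiagonal.mem_antidiagonal] at hp
    have hB1 : 24 * (p.1 : ℤ) + 1 ≤ 24 * N + 2 := by omega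
    have hB2 : 24 * (p.2 : ℤ) + 1 ≤ 24 * N + 2 := by omega
    have : ∑ q ∈ circlePoints N with ((q.1 ^ 2 / 24).toNat, (q.2 ^ 2 / 24).toNat) = p,
        residueWeight (q.1 ^ 2 / 24).toNat (q.2 ^ 2 / 24).toNat * (chiTwelve q.1 * chiTwelve q.2) =
        residueWeight p.1 p.2 * ∑ q ∈ (Finset.Icc (-(24 * N + 2 : ℤ)) (24 * N + 2)).filter
            (fun x ↦ x ^ 2 = 24 * (p.1 : ℤ) + 1) ×ˢ (Finset.Icc (-(24 * N + 2 : ℤ)) (24 * N + 2)).filter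
            (fun x ↦ x ^ 2 = 24 * (p.2 : ℤ) + 1), chiTwelve q.1 * chiTwelve q.2 := by
      rw [Finset.mul_sum]
      refine Finset.sum_subset_zero_on_sdiff (fun q hq ↦ ?_) (fun q hq ↦ ?_) fun q hq ↦ ?_
      · obtain ⟨hq', rfl⟩ := Finset.mem_filter.mp hq
        have := hmaps q hq'
        rw [circlePoints, Finset.mem_filter, Finset.mem_product] at hq'
        simp only [Finset.mem_product, Finset.mem_filter]
        exact ⟨⟨hq'.1.1, this.2.1⟩, hq'.1.2, this.2.2⟩
      · simp only [Finset.mem_sdiff, Finset.mem_product, Finset.mem_filter, mem_circlePoints] at hq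
        by_contra h0
        refine hq.2 ⟨⟨?_, right_ne_zero_of_mul h0⟩, ?_⟩
        · rw [hq.1.1.2, hq.1.2.2, ← hp]; push_cast; ring
        · rw [hq.1.1.2, hq.1.2.2]; ext <;> dsimp only <;> omega
      · obtain ⟨-, rfl⟩ := Finset.mem_filter.mp hq
        rfl
    rw [this, Finset.sum_product]
    dsimp only
    rw [← Finset.sum_mul_sum, sum_chiTwelve_sq_eq hB1, sum_chiTwelve_sq_eq hB2]
    ring
  linarith

end Circle

/-! ### The relation between the components of the dissection. -/

namespace PowerSeries

theorem coeff_X_mul_expand5_expand5_pentagonalSeries (n : ℕ) :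
    coeff n (X * expand5 (expand5 (pentagonalSeries ℤ))) =
      if n % 5 = 1 then -coeff n (pentagonalSeries ℤ) else 0 := by
  rw [← neg_neg (expand5 (pentagonalSeries ℤ)), ← sec_one_pentagonalSeries, map_neg, mul_neg,
    map_neg]
  rcases n with _ | n
  · simp
  · rw [coeff_succ_X_mul, coeff_expand, coeff_sec]
    by_cases h : 5 ∣ n
    · rw [if_pos h, if_pos (by omega), Nat.mul_div_cancel' h]
    · rw [if_neg h, if_neg (by omega), neg_zero]

/-- The weight 1 everywhere produces P^2; the excess weight at i ≡ j ≡ 1 mod 5 produces the square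
of the middle component X P(X^25). Other residues either agree with weight 1 or have zero
coefficients. -/
theorem sec_two_sq_add :
    sec 2 (pentagonalSeries ℤ ^ 2) + expand5 (pentagonalSeries ℤ) ^ 2 = 0 := by
  have h : expand5 (pentagonalSeries ℤ) ^ 2 =
      sec 2 ((X * expand5 (expand5 (pentagonalSeries ℤ))) ^ 2) := by
    rw [mul_pow, ← map_pow expand5 (expand5 (pentagonalSeries ℤ)) 2,
      sec_X_pow_mul_expand5 (by norm_num) (by norm_num), if_pos rfl]
  rw [h, ← map_add]
  ext n
  rw [coeff_sec, map_zero, map_add, pow_two, pow_two, coeff_mul, coeff_mul,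
    ← Finset.sum_add_distrib, ← sum_antidiagonal_residueWeight (N := 5 * n + 2) (by omega)]
  refine Finset.sum_congr rfl fun p hp ↦ ?_
  rw [Finset.HasAntidiagonal.mem_antidiagonal] at hp
  have hz {i : ℕ} (hi : i % 5 = 3 ∨ i % 5 = 4) : coeff i (pentagonalSeries ℤ) = 0 := by
    refine coeff_pentagonalSeries_eq_zero ℤ fun ⟨k, hk⟩ ↦ ?_
    have := pentagonal_mod_five k
    omega
  rw [coeff_X_mul_expand5_expand5_pentagonalSeries, coeff_X_mul_expand5_expand5_pentagonalSeries,
    residueWeight]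
  by_cases h1 : p.1 % 5 = 1
  · have h2 : p.2 % 5 = 1 := by omega
    simp only [h1, h2, if_true, and_self]
    ring
  · simp only [h1, if_false, false_and, zero_mul, add_zero]
    by_cases h3 : p.1 % 5 = 3 ∨ p.1 % 5 = 4
    · simp [hz h3]
    · rw [if_neg (by omega), one_mul]

/-- Expanding P^2 gives its section at 2 as 2AQ + P(X^5)^2, and the previous identity leaves twice
the claim. Over the integers the 2 cancels; base change then reaches every ring. -/
theorem sec_zero_mul_sec_two_int :
    sec 0 (pentagonalSeries ℤ) * sec 2 (pentagonalSeries ℤ) =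
      -expand5 (pentagonalSeries ℤ) ^ 2 := by
  have h := sec_two_sq_add
  set A := sec 0 (pentagonalSeries ℤ) with hA
  set Q := sec 2 (pentagonalSeries ℤ) with hQ
  have h1 : pentagonalSeries ℤ ^ 2 = X ^ 0 * expand5 (A ^ 2) +
      X ^ 1 * expand5 (-2 * (A * expand5 (pentagonalSeries ℤ))) +
      X ^ 2 * expand5 (2 * (A * Q) + expand5 (pentagonalSeries ℤ) ^ 2) +
      X ^ 3 * expand5 (-2 * (expand5 (pentagonalSeries ℤ) * Q)) +
      X ^ 4 * expand5 (Q ^ 2) := by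
    conv_lhs => rw [pentagonalSeries_eq_dissection]
    simp only [map_add, map_mul, map_pow, map_neg, map_ofNat]
    ring
  have hs (k : ℕ) (hk : k < 5) (u : ℤ⟦X⟧) : sec 2 (X ^ k * expand5 u) = if 2 = k then u else 0 :=
    sec_X_pow_mul_expand5 (by norm_num) hk u
  rw [h1, map_add, map_add, map_add, map_add, hs 0 (by norm_num), hs 1 (by norm_num),
    hs 2 (by norm_num), hs 3 (by norm_num), hs 4 (by norm_num)] at h
  norm_num at h
  have h2 : (2 : ℤ⟦X⟧) * (A * Q + expand5 (pentagonalSeries ℤ) ^ 2) = 0 := by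
    linear_combination h
  have h3 : (2 : ℤ⟦X⟧) ≠ 0 := by
    intro h0
    have := congrArg constantCoeff h0
    rw [map_ofNat, map_zero] at this
    norm_num at this
  exact eq_neg_of_add_eq_zero_left ((mul_eq_zero.mp h2).resolve_left h3)

theorem map_pentagonalSeries {R S : Type*} [CommRing R] [CommRing S] (φ : R →+* S) :
    map φ (pentagonalSeries R) = pentagonalSeries S := by
  ext n
  rw [coeff_map]
  by_cases h : n ∈ Set.range pentagonal
  · obtain ⟨k, rfl⟩ := h
    rw [coeff_pentagonalSeries_pentagonal, coeff_pentagonalSeries_pentagonal, map_intCast]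
  · rw [coeff_pentagonalSeries_eq_zero R h, coeff_pentagonalSeries_eq_zero S h, map_zero]

theorem map_sec {R S : Type*} [CommRing R] [CommRing S] (φ : R →+* S) (r : ℕ) (f : R⟦X⟧) :
    map φ (sec r f) = sec r (map φ f) := by
  ext n
  simp [coeff_sec]

theorem sec_zero_mul_sec_two (R : Type*) [CommRing R] :
    sec 0 (pentagonalSeries R) * sec 2 (pentagonalSeries R) =
      -expand5 (pentagonalSeries R) ^ 2 := by
  have h := congrArg (map (Int.castRingHom R)) sec_zero_mul_sec_two_int
  simpa only [map_mul, map_neg, map_pow, map_sec, map_expand, map_pentagonalSeries] using h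

end PowerSeries

/-! ### Infinite products. -/

namespace PowerSeries

section Topology
open WithPiTopology
variable {R : Type*} [CommRing R] [TopologicalSpace R]

theorem continuous_of_continuous_coeff {φ : R⟦X⟧ → R⟦X⟧}
    (h : ∀ n, Continuous fun f ↦ coeff n (φ f)) : Continuous φ := by
  refine continuous_iff_continuousAt.mpr fun f ↦ ?_
  rw [ContinuousAt, tendsto_iff_coeff_tendsto]
  exact fun n ↦ (h n).tendsto f

theorem hasProd_expand_one_sub_X_pow {k : ℕ} (hk : k ≠ 0) :
    HasProd (fun n ↦ (1 - X ^ (k * (n + 1)) : R⟦X⟧)) (expand k hk (pentagonalSeries R)) := by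
  have hc : Continuous (expand k hk : R⟦X⟧ → R⟦X⟧) := by
    refine continuous_of_continuous_coeff fun n ↦ ?_
    simp only [coeff_expand]
    split_ifs
    · exact continuous_coeff R _
    · exact continuous_const
  have := (hasProd_one_sub_X_pow R).map (expand k hk) hc
  simpa [Function.comp_def, pow_mul] using this

theorem hasProd_rescale_one_sub_X_pow [IsTopologicalRing R] (z : R) :
    HasProd (fun n ↦ (1 - C (z ^ (n + 1)) * X ^ (n + 1) : R⟦X⟧))
      (rescale z (pentagonalSeries R)) := by
  have hc : Continuous (rescale z : R⟦X⟧ → R⟦X⟧) := by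
    refine continuous_of_continuous_coeff fun n ↦ ?_
    simp only [coeff_rescale]
    exact (continuous_coeff R n).const_mul _
  have := (hasProd_one_sub_X_pow R).map (rescale z) hc
  simpa [Function.comp_def, rescale_X, mul_pow] using this

/-- The factors of Euler's product at the multiples of `k`. -/
theorem hasProd_ite_dvd {k : ℕ} (hk : k ≠ 0) (F : ℕ → R⟦X⟧) {a : R⟦X⟧}
    (h : HasProd (fun n ↦ F (k * (n + 1))) a) :
    HasProd (fun n ↦ if k ∣ n + 1 then F (n + 1) else 1) a := by
  have hinj : Function.Injective fun n ↦ k * (n + 1) - 1 := by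
    intro a b hab
    have ha : 1 ≤ k * (a + 1) := Nat.mul_pos (Nat.pos_of_ne_zero hk) (Nat.succ_pos a)
    have hb : 1 ≤ k * (b + 1) := Nat.mul_pos (Nat.pos_of_ne_zero hk) (Nat.succ_pos b)
    have : k * (a + 1) = k * (b + 1) := by
      dsimp only at hab
      omega
    exact Nat.succ_injective (Nat.eq_of_mul_eq_mul_left (Nat.pos_of_ne_zero hk) this)
  rw [← hinj.hasProd_iff]
  · refine h.congr_fun fun n ↦ ?_
    have : k * (n + 1) - 1 + 1 = k * (n + 1) :=
      Nat.sub_add_cancel (Nat.mul_pos (Nat.pos_of_ne_zero hk) (Nat.succ_pos n))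
    simp [this]
  · intro n hn
    refine if_neg fun ⟨m, hm⟩ ↦ hn ⟨m - 1, ?_⟩
    have : m ≠ 0 := by rintro rfl; omega
    dsimp only
    rw [Nat.sub_add_cancel (Nat.one_le_iff_ne_zero.mpr this), ← hm, Nat.add_sub_cancel]

end Topology

/-! ### The norm over fifth roots of unity and the quintic equation. -/

section Norm
variable {K : Type*} [Field K]

/-- If 5 ∤ n, multiplication by n permutes the exponents j modulo 5; otherwise every factor is 1 -
x. -/
theorem prod_one_sub_pow_mul {S : Type*} [CommRing S] {z : S} (hz : z ^ 5 = 1)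
    (hz' : 1 + z + z ^ 2 + z ^ 3 + z ^ 4 = 0) (n : ℕ) (x : S) :
    ∏ j ∈ Finset.range 5, (1 - (z ^ j) ^ n * x) = if 5 ∣ n then (1 - x) ^ 5 else 1 - x ^ 5 := by
  have hp (j : ℕ) : (z ^ j) ^ n = z ^ (j * n % 5) := by
    rw [← pow_mul, ← Nat.div_add_mod (j * n) 5, pow_add, pow_mul, hz, one_pow, one_mul,
      Nat.mul_add_mod, Nat.mod_mod]
  have h1 : (1 - z * x) * (1 - z ^ 4 * x) = 1 - (z + z ^ 4) * x + x ^ 2 := by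
    linear_combination x ^ 2 * hz
  have h2 : (1 - z ^ 2 * x) * (1 - z ^ 3 * x) = 1 - (z ^ 2 + z ^ 3) * x + x ^ 2 := by
    linear_combination x ^ 2 * hz
  have h3 : (z + z ^ 4) * (z ^ 2 + z ^ 3) = -1 := by linear_combination hz' + (z + z ^ 2) * hz
  have key : (1 - x) * (1 - z * x) * (1 - z ^ 2 * x) * (1 - z ^ 3 * x) * (1 - z ^ 4 * x) =
      1 - x ^ 5 := by
    calc _ = (1 - x) * ((1 - z * x) * (1 - z ^ 4 * x)) * ((1 - z ^ 2 * x) * (1 - z ^ 3 * x)) := by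
          ring
      _ = _ := by
          rw [h1, h2]
          linear_combination (1 - x) * x ^ 2 * h3 - (1 - x) * (x + x ^ 3) * hz'
  simp only [hp, Finset.prod_range_succ, Finset.prod_range_zero, one_mul, zero_mul]
  have h5 : n % 5 = 0 ∨ n % 5 = 1 ∨ n % 5 = 2 ∨ n % 5 = 3 ∨ n % 5 = 4 := by omega
  rcases h5 with h | h | h | h | h
  · rw [h, show 2 * n % 5 = 0 by omega, show 3 * n % 5 = 0 by omega, show 4 * n % 5 = 0 by omega,
      if_pos (by omega)]
    ring
  · rw [h, show 2 * n % 5 = 2 by omega, show 3 * n % 5 = 3 by omega, show 4 * n % 5 = 4 by omega,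
      if_neg (by omega), ← key]
    ring
  · rw [h, show 2 * n % 5 = 4 by omega, show 3 * n % 5 = 1 by omega, show 4 * n % 5 = 3 by omega,
      if_neg (by omega), ← key]
    ring
  · rw [h, show 2 * n % 5 = 1 by omega, show 3 * n % 5 = 4 by omega, show 4 * n % 5 = 2 by omega,
      if_neg (by omega), ← key]
    ring
  · rw [h, show 2 * n % 5 = 3 by omega, show 3 * n % 5 = 2 by omega, show 4 * n % 5 = 1 by omega,
      if_neg (by omega), ← key]
    ring

/-- The product of the conjugates of Euler's function over the fifth roots of unity. -/
theorem prod_rescale_pentagonalSeries {z : K} (hz : IsPrimitiveRoot z 5) :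
    (∏ j ∈ Finset.range 5, rescale (z ^ j) (pentagonalSeries K)) *
      expand5 (expand5 (pentagonalSeries K)) = expand5 (pentagonalSeries K) ^ 6 := by
  -- The discrete topology on coefficients only serves to compare infinite products factor by
  -- factor.
  let : TopologicalSpace K := ⊥
  have : DiscreteTopology K := ⟨rfl⟩
  open WithPiTopology in
  have h0 : HasProd (fun n ↦ (1 - X ^ (5 * (n + 1)) : K⟦X⟧)) (expand5 (pentagonalSeries K)) :=
    hasProd_expand_one_sub_X_pow _
  have h1 : HasProd (fun n ↦ if 5 ∣ n + 1 then (1 - X ^ (n + 1) : K⟦X⟧) ^ 5 else 1)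
      (expand5 (pentagonalSeries K) ^ 5) :=
    hasProd_ite_dvd (by norm_num) (fun n ↦ (1 - X ^ n : K⟦X⟧) ^ 5) (h0.pow 5)
  have h2 : HasProd (fun n ↦ if 5 ∣ n + 1 then (1 - X ^ (5 * (n + 1)) : K⟦X⟧) else 1)
      (expand5 (expand5 (pentagonalSeries K))) := by
    refine hasProd_ite_dvd (by norm_num) (fun n ↦ (1 - X ^ (5 * n) : K⟦X⟧)) ?_
    rw [← expand_mul]
    simpa only [mul_assoc] using hasProd_expand_one_sub_X_pow (R := K) (k := 5 * 5) (by norm_num)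
  have h3 := (hasProd_prod fun j (_ : j ∈ Finset.range 5) ↦
    hasProd_rescale_one_sub_X_pow (z ^ j)).mul h2
  have h4 := h0.mul h1
  rw [show expand5 (pentagonalSeries K) ^ 6 =
    expand5 (pentagonalSeries K) * expand5 (pentagonalSeries K) ^ 5 by ring]
  refine h3.unique (h4.congr_fun fun n ↦ ?_)
  have hz5 : (C z : K⟦X⟧) ^ 5 = 1 := by rw [← map_pow, hz.pow_eq_one, map_one]
  have hzs : (1 + C z + C z ^ 2 + C z ^ 3 + C z ^ 4 : K⟦X⟧) = 0 := by
    have := hz.geom_sum_eq_zero (by norm_num)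
    simp only [Finset.sum_range_succ, Finset.sum_range_zero, zero_add, pow_zero, pow_one] at this
    simpa using congrArg (C : K →+* K⟦X⟧) this
  have := prod_one_sub_pow_mul hz5 hzs (n + 1) (X ^ (n + 1))
  simp only [← map_pow] at this ⊢
  rw [this]
  split_ifs <;> ring

theorem rescale_expand5 {z : K} (hz : z ^ 5 = 1) (u : K⟦X⟧) :
    rescale z (expand5 u) = expand5 u := by
  ext n
  rw [coeff_rescale, coeff_expand]
  split_ifs with h
  · obtain ⟨m, rfl⟩ := h
    rw [pow_mul, hz, one_pow, one_mul]
  · rw [mul_zero]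

/-- Pairing j with 5 - j leaves the periods s = z + z^4 and t = z^2 + z^3, with s + t = st = -1.
With ac = -b^2, everything depends only on b and a + c. -/
theorem prod_quadratic {S : Type*} [CommRing S] {z a b c : S} (hz : z ^ 5 = 1)
    (hz' : 1 + z + z ^ 2 + z ^ 3 + z ^ 4 = 0) (h : a * c = -b ^ 2) :
    ∏ j ∈ Finset.range 5, (a - z ^ j * b + (z ^ j) ^ 2 * c) = a ^ 5 - 11 * b ^ 5 + c ^ 5 := by
  have h1 : (a - z * b + z ^ 2 * c) * (a - z ^ 4 * b + (z ^ 4) ^ 2 * c) =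
      a ^ 2 + b ^ 2 + c ^ 2 - (z + z ^ 4) * (a * b + b * c) + (z ^ 2 + z ^ 3) * (a * c) := by
    linear_combination
      (b ^ 2 + (z ^ 5 + 1) * c ^ 2 + z ^ 3 * (a * c) - (z ^ 4 + z) * (b * c)) * hz
  have h2 : (a - z ^ 2 * b + (z ^ 2) ^ 2 * c) * (a - z ^ 3 * b + (z ^ 3) ^ 2 * c) =
      a ^ 2 + b ^ 2 + c ^ 2 - (z ^ 2 + z ^ 3) * (a * b + b * c) + (z + z ^ 4) * (a * c) := by
    linear_combination
      (b ^ 2 + (z ^ 5 + 1) * c ^ 2 + z * (a * c) - (z ^ 3 + z ^ 2) * (b * c)) * hz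
  have h3 : (z + z ^ 4) * (z ^ 2 + z ^ 3) = -1 := by linear_combination hz' + (z + z ^ 2) * hz
  have h4 : z ^ 2 + z ^ 3 = -1 - (z + z ^ 4) := by linear_combination hz'
  have h5 : a ^ 2 + b ^ 2 + c ^ 2 = (a + c) ^ 2 + 3 * b ^ 2 := by linear_combination -2 * h
  have h6 : a ^ 5 + c ^ 5 = (a + c) ^ 5 + 5 * b ^ 2 * (a + c) ^ 3 + 5 * b ^ 4 * (a + c) := by
    linear_combination (-5 * (a + c) ^ 3 + 5 * (a + c) * (a * c - b ^ 2)) * h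
  rw [show a ^ 5 - 11 * b ^ 5 + c ^ 5 = a ^ 5 + c ^ 5 - 11 * b ^ 5 by ring, h6]
  simp only [Finset.prod_range_succ, Finset.prod_range_zero, pow_zero, pow_one, one_mul, one_pow]
  calc _ = (a + c - b) * ((a - z * b + z ^ 2 * c) * (a - z ^ 4 * b + (z ^ 4) ^ 2 * c)) *
        ((a - z ^ 2 * b + (z ^ 2) ^ 2 * c) * (a - z ^ 3 * b + (z ^ 3) ^ 2 * c)) := by ring
    _ = _ := by
      rw [h1, h2, h5, h, show a * b + b * c = b * (a + c) by ring]
      generalize a + c = v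
      generalize z ^ 2 + z ^ 3 = t at *
      generalize z + z ^ 4 = s at *
      subst h4
      linear_combination (v - b) * (b ^ 2 * v ^ 2 + b ^ 4 - 2 * b ^ 3 * v) * h3

/-- The norm `A ^ 5 - 11 * X * B ^ 5 + X ^ 2 * C ^ 5` of Euler's function
`A(X ^ 5) - X * B(X ^ 5) + X ^ 2 * C(X ^ 5)` over the series in `X ^ 5`, as a series in `X`. -/
noncomputable def eulerNorm (R : Type*) [CommRing R] : R⟦X⟧ :=
  sec 0 (pentagonalSeries R) ^ 5 - 11 * X * expand5 (pentagonalSeries R) ^ 5 +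
    X ^ 2 * sec 2 (pentagonalSeries R) ^ 5

theorem expand5_injective {R : Type*} [CommRing R] : Function.Injective (expand5 (R := R)) := by
  intro f g h
  ext n
  simpa only [coeff_expand_mul] using congrArg (coeff (5 * n)) h

/-- After X ↦ X^5 the norm is the product of the conjugates P(z^j X), evaluated by Euler's product.
-/
theorem eulerNorm_mul {z : K} (hz : IsPrimitiveRoot z 5) :
    eulerNorm K * expand5 (pentagonalSeries K) = pentagonalSeries K ^ 6 := by
  apply expand5_injective
  rw [map_mul, map_pow, ← prod_rescale_pentagonalSeries hz]
  congr 1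
  have hz5 : (C z : K⟦X⟧) ^ 5 = 1 := by rw [← map_pow, hz.pow_eq_one, map_one]
  have hzs : (1 + C z + C z ^ 2 + C z ^ 3 + C z ^ 4 : K⟦X⟧) = 0 := by
    have := hz.geom_sum_eq_zero (by norm_num)
    simp only [Finset.sum_range_succ, Finset.sum_range_zero, zero_add, pow_zero, pow_one] at this
    simpa using congrArg (C : K →+* K⟦X⟧) this
  have hac := congrArg expand5 (sec_zero_mul_sec_two K)
  rw [map_mul, map_neg, map_pow] at hac
  have := prod_quadratic (a := expand5 (sec 0 (pentagonalSeries K)))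
    (b := X * expand5 (expand5 (pentagonalSeries K)))
    (c := X ^ 2 * expand5 (sec 2 (pentagonalSeries K))) hz5 hzs (by linear_combination X ^ 2 * hac)
  rw [eulerNorm, map_add, map_sub, map_mul, map_mul, map_mul, map_pow, map_pow, map_pow, map_pow,
    expand_X, map_ofNat]
  refine Eq.trans ?_ (this.symm.trans ?_)
  · ring
  refine Finset.prod_congr rfl fun j _ ↦ ?_
  have hj : (z ^ j) ^ 5 = 1 := by rw [← pow_mul, mul_comm, pow_mul, hz.pow_eq_one, one_pow]
  conv_rhs => rw [pentagonalSeries_eq_dissection K]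
  rw [map_add, map_sub, map_mul, map_mul, map_pow, rescale_expand5 hj, rescale_expand5 hj,
    rescale_expand5 hj, rescale_X, map_pow]
  ring

/-- The quintic equation of Euler's function over the series in `X ^ 5`. -/
theorem quintic_pentagonalSeries (R : Type*) [CommRing R] :
    pentagonalSeries R ^ 5 +
      5 * (X * expand5 (expand5 (pentagonalSeries R))) * pentagonalSeries R ^ 4 +
      15 * (X * expand5 (expand5 (pentagonalSeries R))) ^ 2 * pentagonalSeries R ^ 3 +
      25 * (X * expand5 (expand5 (pentagonalSeries R))) ^ 3 * pentagonalSeries R ^ 2 +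
      25 * (X * expand5 (expand5 (pentagonalSeries R))) ^ 4 * pentagonalSeries R =
    expand5 (eulerNorm R) := by
  have hac := congrArg expand5 (sec_zero_mul_sec_two R)
  rw [map_mul, map_neg, map_pow] at hac
  rw [eulerNorm, map_add, map_sub, map_mul, map_mul, map_mul, map_pow, map_pow, map_pow, map_pow,
    expand_X, map_ofNat]
  have hP := pentagonalSeries_eq_dissection R
  generalize pentagonalSeries R = P at *
  generalize expand5 (expand5 P) = b at *
  generalize expand5 (sec 0 P) = a at *
  generalize expand5 (sec 2 P) = c at *
  -- The outer components have product -(Xb)^2 and sum P + Xb, so their fifth power sum is a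
  -- polynomial in P and Xb.
  have h6 : a ^ 5 + (X ^ 2 * c) ^ 5 = (a + X ^ 2 * c) ^ 5 +
      5 * (X * b) ^ 2 * (a + X ^ 2 * c) ^ 3 + 5 * (X * b) ^ 4 * (a + X ^ 2 * c) := by
    linear_combination (-5 * (a + X ^ 2 * c) ^ 3 +
      5 * (a + X ^ 2 * c) * (a * (X ^ 2 * c) - (X * b) ^ 2)) * (X ^ 2 * hac)
  have hv : a + X ^ 2 * c = P + X * b := by linear_combination -hP
  rw [hv] at h6
  linear_combination -h6

end Norm
end PowerSeries

/-! ### Sections of P^e at the residue e mod 5. -/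

namespace PowerSeries

section Powers
variable (R : Type*) [CommRing R]

variable {R} in
-- Trading k factors P for k factors X u(X^5) lowers both the power and the residue by k, so the
-- sections at e mod 5 form a closed family; a wrap past 0 costs a factor X.
theorem sec_X_mul_expand5_pow_mul {r k : ℕ} (hr : r < 5) (hk : k < 5) (u f : R⟦X⟧) :
    sec r ((X * expand5 u) ^ k * f) =
      u ^ k * if k ≤ r then sec (r - k) f else X * sec (r + 5 - k) f := by
  rw [mul_pow, mul_comm (X ^ k), mul_assoc, ← map_pow, sec_expand5_mul hr]
  split_ifs with h
  · obtain ⟨j, rfl⟩ := Nat.exists_eq_add_of_le' h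
    rw [sec_add_X_pow_mul, Nat.add_sub_cancel]
  · rw [sec_X_pow_mul_of_lt (by omega) (by omega)]

/-- The quintic equation as a recurrence for the sections of the powers of Euler's function. -/
theorem sec_pentagonalSeries_pow_five_mul {r : ℕ} (hr : r < 5) (f : R⟦X⟧) :
    sec r (pentagonalSeries R ^ 5 * f) = eulerNorm R * sec r f -
      5 * (expand5 (pentagonalSeries R) *
        if 1 ≤ r then sec (r - 1) (pentagonalSeries R ^ 4 * f)
        else X * sec (r + 5 - 1) (pentagonalSeries R ^ 4 * f)) -
      15 * (expand5 (pentagonalSeries R) ^ 2 *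
        if 2 ≤ r then sec (r - 2) (pentagonalSeries R ^ 3 * f)
        else X * sec (r + 5 - 2) (pentagonalSeries R ^ 3 * f)) -
      25 * (expand5 (pentagonalSeries R) ^ 3 *
        if 3 ≤ r then sec (r - 3) (pentagonalSeries R ^ 2 * f)
        else X * sec (r + 5 - 3) (pentagonalSeries R ^ 2 * f)) -
      25 * (expand5 (pentagonalSeries R) ^ 4 *
        if 4 ≤ r then sec (r - 4) (pentagonalSeries R * f)
        else X * sec (r + 5 - 4) (pentagonalSeries R * f)) := by
  have h1 := sec_X_mul_expand5_pow_mul hr (k := 1) (by norm_num)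
    (expand5 (pentagonalSeries R)) (pentagonalSeries R ^ 4 * f)
  rw [pow_one, pow_one] at h1
  rw [← sec_expand5_mul hr, ← h1,
    ← sec_X_mul_expand5_pow_mul hr (by norm_num : 2 < 5),
    ← sec_X_mul_expand5_pow_mul hr (by norm_num : 3 < 5),
    ← sec_X_mul_expand5_pow_mul hr (by norm_num : 4 < 5), ← quintic_pentagonalSeries]
  have hs (m : ℕ) (v : R⟦X⟧) : (m : R⟦X⟧) * sec r v = sec r ((m : R⟦X⟧) * v) := by
    rw [← nsmul_eq_mul, ← nsmul_eq_mul, map_nsmul]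
  have h5 (v : R⟦X⟧) : 5 * sec r v = sec r (5 * v) := by exact_mod_cast hs 5 v
  have h15 (v : R⟦X⟧) : 15 * sec r v = sec r (15 * v) := by exact_mod_cast hs 15 v
  have h25 (v : R⟦X⟧) : 25 * sec r v = sec r (25 * v) := by exact_mod_cast hs 25 v
  rw [h5, h15, h25, h25, ← map_sub, ← map_sub, ← map_sub, ← map_sub]
  congr 1
  ring

theorem sec_zero_one : sec 0 (1 : R⟦X⟧) = 1 := by
  simpa using sec_X_pow_mul_expand5 (r := 0) (k := 0) (by norm_num) (by norm_num) (1 : R⟦X⟧)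

/-- The sections of the powers of Euler's function, in terms of those of Euler's function. -/
theorem sec_pentagonalSeries_pow_of_dissection {e r : ℕ} (hr : r < 5) {u : ℕ → R⟦X⟧}
    (h : pentagonalSeries R ^ e = ∑ k ∈ Finset.range 5, X ^ k * expand5 (u k)) :
    sec r (pentagonalSeries R ^ e) = u r := by
  rw [h, map_sum, Finset.sum_congr rfl fun k hk ↦
    sec_X_pow_mul_expand5 hr (Finset.mem_range.mp hk) (u k)]
  simp [hr]

theorem sec_pentagonalSeries_pow_two :
    sec 2 (pentagonalSeries R ^ 2) = -expand5 (pentagonalSeries R) ^ 2 := by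
  have hac := sec_zero_mul_sec_two R
  have hP := pentagonalSeries_eq_dissection R
  set A := sec 0 (pentagonalSeries R)
  set Q := sec 2 (pentagonalSeries R)
  set g := expand5 (pentagonalSeries R)
  rw [sec_pentagonalSeries_pow_of_dissection R (by norm_num) (u := fun k ↦ match k with
    | 0 => 1 * (A ^ 2)
    | 1 => -2 * (A * g)
    | 2 => 1 * (g ^ 2) + 2 * (A * Q)
    | 3 => -2 * (g * Q)
    | _ => 1 * (Q ^ 2))]
  · change 1 * (g ^ 2) + 2 * (A * Q) = _
    linear_combination 2 * hac
  · simp only [Finset.sum_range_succ, Finset.sum_range_zero, map_add, map_neg, map_mul,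
      map_pow, map_ofNat, map_one]
    conv_lhs => rw [hP]
    ring

theorem sec_pentagonalSeries_pow_three :
    sec 3 (pentagonalSeries R ^ 3) = 5 * expand5 (pentagonalSeries R) ^ 3 := by
  have hac := sec_zero_mul_sec_two R
  have hP := pentagonalSeries_eq_dissection R
  set A := sec 0 (pentagonalSeries R)
  set Q := sec 2 (pentagonalSeries R)
  set g := expand5 (pentagonalSeries R)
  -- Each `u k` collects the terms of the expanded cube with exponent k modulo 5; a factor X records
  -- an exponent of at least 5.
  rw [sec_pentagonalSeries_pow_of_dissection R (by norm_num) (u := fun k ↦ match k with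
    | 0 => -3 * (X * g * Q ^ 2) + 1 * (A ^ 3)
    | 1 => 1 * (X * Q ^ 3) - 3 * (A ^ 2 * g)
    | 2 => 3 * (A * g ^ 2) + 3 * (A ^ 2 * Q)
    | 3 => -1 * (g ^ 3) - 6 * (A * g * Q)
    | _ => 3 * (g ^ 2 * Q) + 3 * (A * Q ^ 2))]
  · change -1 * (g ^ 3) - 6 * (A * g * Q) = _
    linear_combination -6 * g * hac
  · simp only [Finset.sum_range_succ, Finset.sum_range_zero, map_add, map_sub, map_neg, map_mul,
      map_pow, map_ofNat, map_one, expand_X]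
    conv_lhs => rw [hP]
    ring

theorem sec_pentagonalSeries_pow_four :
    sec 4 (pentagonalSeries R ^ 4) = -(5 * expand5 (pentagonalSeries R) ^ 4) := by
  have hac := sec_zero_mul_sec_two R
  have hP := pentagonalSeries_eq_dissection R
  set A := sec 0 (pentagonalSeries R)
  set Q := sec 2 (pentagonalSeries R)
  set g := expand5 (pentagonalSeries R)
  rw [sec_pentagonalSeries_pow_of_dissection R (by norm_num) (u := fun k ↦ match k with
    | 0 => -4 * (X * g ^ 3 * Q) - 12 * (X * A * g * Q ^ 2) + 1 * (A ^ 4)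
    | 1 => 6 * (X * g ^ 2 * Q ^ 2) + 4 * (X * A * Q ^ 3) - 4 * (A ^ 3 * g)
    | 2 => -4 * (X * g * Q ^ 3) + 6 * (A ^ 2 * g ^ 2) + 4 * (A ^ 3 * Q)
    | 3 => 1 * (X * Q ^ 4) - 4 * (A * g ^ 3) - 12 * (A ^ 2 * g * Q)
    | _ => 1 * (g ^ 4) + 12 * (A * g ^ 2 * Q) + 6 * (A ^ 2 * Q ^ 2))]
  · change 1 * (g ^ 4) + 12 * (A * g ^ 2 * Q) + 6 * (A ^ 2 * Q ^ 2) = _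
    linear_combination (6 * (A * Q - g ^ 2) + 12 * g ^ 2) * hac
  · simp only [Finset.sum_range_succ, Finset.sum_range_zero, map_add, map_sub, map_neg, map_mul,
      map_pow, map_ofNat, map_one, expand_X]
    conv_lhs => rw [hP]
    ring

theorem sec_pentagonalSeries_pow_5 :
    sec 0 (pentagonalSeries R ^ 5) = eulerNorm R := by
  have h := sec_pentagonalSeries_pow_five_mul R (r := 0) (by norm_num) (pentagonalSeries R ^ 0)
  simp only [← pow_add, ← pow_succ'] at h
  norm_num at h
  rw [h, sec_pentagonalSeries_pow_four, sec_pentagonalSeries_pow_three,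
    sec_pentagonalSeries_pow_two, sec_one_pentagonalSeries,
    sec_zero_one]
  ring

theorem sec_pentagonalSeries_pow_6 :
    sec 1 (pentagonalSeries R ^ 6) = -(6 * eulerNorm R * expand5 (pentagonalSeries R)) -
      25 * X * expand5 (pentagonalSeries R) ^ 6 := by
  have h := sec_pentagonalSeries_pow_five_mul R (r := 1) (by norm_num) (pentagonalSeries R ^ 1)
  simp only [← pow_add, ← pow_succ'] at h
  norm_num at h
  rw [h, sec_pentagonalSeries_pow_5, sec_pentagonalSeries_pow_four,
    sec_pentagonalSeries_pow_three, sec_pentagonalSeries_pow_two,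
    sec_one_pentagonalSeries]
  ring

theorem sec_pentagonalSeries_pow_7 :
    sec 2 (pentagonalSeries R ^ 7) = 14 * eulerNorm R * expand5 (pentagonalSeries R) ^ 2 +
      125 * X * expand5 (pentagonalSeries R) ^ 7 := by
  have h := sec_pentagonalSeries_pow_five_mul R (r := 2) (by norm_num) (pentagonalSeries R ^ 2)
  simp only [← pow_add, ← pow_succ'] at h
  norm_num at h
  rw [h, sec_pentagonalSeries_pow_6, sec_pentagonalSeries_pow_5,
    sec_pentagonalSeries_pow_four, sec_pentagonalSeries_pow_three,
    sec_pentagonalSeries_pow_two]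
  ring

theorem sec_pentagonalSeries_pow_8 :
    sec 3 (pentagonalSeries R ^ 8) = -(125 * X * expand5 (pentagonalSeries R) ^ 8) := by
  have h := sec_pentagonalSeries_pow_five_mul R (r := 3) (by norm_num) (pentagonalSeries R ^ 3)
  simp only [← pow_add, ← pow_succ'] at h
  norm_num at h
  rw [h, sec_pentagonalSeries_pow_7, sec_pentagonalSeries_pow_6,
    sec_pentagonalSeries_pow_5, sec_pentagonalSeries_pow_four,
    sec_pentagonalSeries_pow_three]
  ring

theorem sec_pentagonalSeries_pow_9 :
    sec 4 (pentagonalSeries R ^ 9) = -(90 * eulerNorm R * expand5 (pentagonalSeries R) ^ 4) -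
      625 * X * expand5 (pentagonalSeries R) ^ 9 := by
  have h := sec_pentagonalSeries_pow_five_mul R (r := 4) (by norm_num) (pentagonalSeries R ^ 4)
  simp only [← pow_add, ← pow_succ'] at h
  norm_num at h
  rw [h, sec_pentagonalSeries_pow_8, sec_pentagonalSeries_pow_7,
    sec_pentagonalSeries_pow_6, sec_pentagonalSeries_pow_5,
    sec_pentagonalSeries_pow_four]
  ring

theorem sec_pentagonalSeries_pow_10 :
    sec 0 (pentagonalSeries R ^ 10) = eulerNorm R ^ 2 +
      250 * eulerNorm R * X * expand5 (pentagonalSeries R) ^ 5 +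
      2500 * X ^ 2 * expand5 (pentagonalSeries R) ^ 10 := by
  have h := sec_pentagonalSeries_pow_five_mul R (r := 0) (by norm_num) (pentagonalSeries R ^ 5)
  simp only [← pow_add, ← pow_succ'] at h
  norm_num at h
  rw [h, sec_pentagonalSeries_pow_9, sec_pentagonalSeries_pow_8,
    sec_pentagonalSeries_pow_7, sec_pentagonalSeries_pow_6,
    sec_pentagonalSeries_pow_5]
  ring

theorem sec_pentagonalSeries_pow_11 :
    sec 1 (pentagonalSeries R ^ 11) = -(11 * eulerNorm R ^ 2 * expand5 (pentagonalSeries R)) -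
      275 * eulerNorm R * X * expand5 (pentagonalSeries R) ^ 6 -
      3125 * X ^ 2 * expand5 (pentagonalSeries R) ^ 11 := by
  have h := sec_pentagonalSeries_pow_five_mul R (r := 1) (by norm_num) (pentagonalSeries R ^ 6)
  simp only [← pow_add, ← pow_succ'] at h
  norm_num at h
  rw [h, sec_pentagonalSeries_pow_10, sec_pentagonalSeries_pow_9,
    sec_pentagonalSeries_pow_8, sec_pentagonalSeries_pow_7,
    sec_pentagonalSeries_pow_6]
  ring

theorem sec_pentagonalSeries_pow_12 :
    sec 2 (pentagonalSeries R ^ 12) = 54 * eulerNorm R ^ 2 * expand5 (pentagonalSeries R) ^ 2 -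
      3125 * X ^ 2 * expand5 (pentagonalSeries R) ^ 12 := by
  have h := sec_pentagonalSeries_pow_five_mul R (r := 2) (by norm_num) (pentagonalSeries R ^ 7)
  simp only [← pow_add, ← pow_succ'] at h
  norm_num at h
  rw [h, sec_pentagonalSeries_pow_11, sec_pentagonalSeries_pow_10,
    sec_pentagonalSeries_pow_9, sec_pentagonalSeries_pow_8,
    sec_pentagonalSeries_pow_7]
  ring

theorem sec_pentagonalSeries_pow_13 :
    sec 3 (pentagonalSeries R ^ 13) = -(130 * eulerNorm R ^ 2 * expand5 (pentagonalSeries R) ^ 3) +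
      15625 * X ^ 2 * expand5 (pentagonalSeries R) ^ 13 := by
  have h := sec_pentagonalSeries_pow_five_mul R (r := 3) (by norm_num) (pentagonalSeries R ^ 8)
  simp only [← pow_add, ← pow_succ'] at h
  norm_num at h
  rw [h, sec_pentagonalSeries_pow_12, sec_pentagonalSeries_pow_11,
    sec_pentagonalSeries_pow_10, sec_pentagonalSeries_pow_9,
    sec_pentagonalSeries_pow_8]
  ring

theorem sec_pentagonalSeries_pow_14 :
    sec 4 (pentagonalSeries R ^ 14) = -(15625 * X ^ 2 * expand5 (pentagonalSeries R) ^ 14) := by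
  have h := sec_pentagonalSeries_pow_five_mul R (r := 4) (by norm_num) (pentagonalSeries R ^ 9)
  simp only [← pow_add, ← pow_succ'] at h
  norm_num at h
  rw [h, sec_pentagonalSeries_pow_13, sec_pentagonalSeries_pow_12,
    sec_pentagonalSeries_pow_11, sec_pentagonalSeries_pow_10,
    sec_pentagonalSeries_pow_9]
  ring

theorem sec_pentagonalSeries_pow_15 :
    sec 0 (pentagonalSeries R ^ 15) = eulerNorm R ^ 3 +
      1125 * eulerNorm R ^ 2 * X * expand5 (pentagonalSeries R) ^ 5 +
      9375 * eulerNorm R * X ^ 2 * expand5 (pentagonalSeries R) ^ 10 := by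
  have h := sec_pentagonalSeries_pow_five_mul R (r := 0) (by norm_num) (pentagonalSeries R ^ 10)
  simp only [← pow_add, ← pow_succ'] at h
  norm_num at h
  rw [h, sec_pentagonalSeries_pow_14, sec_pentagonalSeries_pow_13,
    sec_pentagonalSeries_pow_12, sec_pentagonalSeries_pow_11,
    sec_pentagonalSeries_pow_10]
  ring

theorem sec_pentagonalSeries_pow_16 :
    sec 1 (pentagonalSeries R ^ 16) = -(16 * eulerNorm R ^ 3 * expand5 (pentagonalSeries R)) -
      4000 * eulerNorm R ^ 2 * X * expand5 (pentagonalSeries R) ^ 6 -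
      50000 * eulerNorm R * X ^ 2 * expand5 (pentagonalSeries R) ^ 11 -
      78125 * X ^ 3 * expand5 (pentagonalSeries R) ^ 16 := by
  have h := sec_pentagonalSeries_pow_five_mul R (r := 1) (by norm_num) (pentagonalSeries R ^ 11)
  simp only [← pow_add, ← pow_succ'] at h
  norm_num at h
  rw [h, sec_pentagonalSeries_pow_15, sec_pentagonalSeries_pow_14,
    sec_pentagonalSeries_pow_13, sec_pentagonalSeries_pow_12,
    sec_pentagonalSeries_pow_11]
  ring

theorem sec_pentagonalSeries_pow_17 :
    sec 2 (pentagonalSeries R ^ 17) = 119 * eulerNorm R ^ 3 * expand5 (pentagonalSeries R) ^ 2 +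
      6375 * eulerNorm R ^ 2 * X * expand5 (pentagonalSeries R) ^ 7 +
      106250 * eulerNorm R * X ^ 2 * expand5 (pentagonalSeries R) ^ 12 +
      390625 * X ^ 3 * expand5 (pentagonalSeries R) ^ 17 := by
  have h := sec_pentagonalSeries_pow_five_mul R (r := 2) (by norm_num) (pentagonalSeries R ^ 12)
  simp only [← pow_add, ← pow_succ'] at h
  norm_num at h
  rw [h, sec_pentagonalSeries_pow_16, sec_pentagonalSeries_pow_15,
    sec_pentagonalSeries_pow_14, sec_pentagonalSeries_pow_13,
    sec_pentagonalSeries_pow_12]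
  ring

theorem sec_pentagonalSeries_pow_18 :
    sec 3 (pentagonalSeries R ^ 18) = -(510 * eulerNorm R ^ 3 * expand5 (pentagonalSeries R) ^ 3) -
      390625 * X ^ 3 * expand5 (pentagonalSeries R) ^ 18 := by
  have h := sec_pentagonalSeries_pow_five_mul R (r := 3) (by norm_num) (pentagonalSeries R ^ 13)
  simp only [← pow_add, ← pow_succ'] at h
  norm_num at h
  rw [h, sec_pentagonalSeries_pow_17, sec_pentagonalSeries_pow_16,
    sec_pentagonalSeries_pow_15, sec_pentagonalSeries_pow_14,
    sec_pentagonalSeries_pow_13]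
  ring

theorem sec_pentagonalSeries_pow_19 :
    sec 4 (pentagonalSeries R ^ 19) = 1140 * eulerNorm R ^ 3 * expand5 (pentagonalSeries R) ^ 4 -
      23750 * eulerNorm R ^ 2 * X * expand5 (pentagonalSeries R) ^ 9 -
      593750 * eulerNorm R * X ^ 2 * expand5 (pentagonalSeries R) ^ 14 -
      1953125 * X ^ 3 * expand5 (pentagonalSeries R) ^ 19 := by
  have h := sec_pentagonalSeries_pow_five_mul R (r := 4) (by norm_num) (pentagonalSeries R ^ 14)
  simp only [← pow_add, ← pow_succ'] at h
  norm_num at h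
  rw [h, sec_pentagonalSeries_pow_18, sec_pentagonalSeries_pow_17,
    sec_pentagonalSeries_pow_16, sec_pentagonalSeries_pow_15,
    sec_pentagonalSeries_pow_14]
  ring

theorem sec_pentagonalSeries_pow_20 :
    sec 0 (pentagonalSeries R ^ 20) = eulerNorm R ^ 4 +
      500 * eulerNorm R ^ 3 * X * expand5 (pentagonalSeries R) ^ 5 +
      68750 * eulerNorm R ^ 2 * X ^ 2 * expand5 (pentagonalSeries R) ^ 10 +
      1562500 * eulerNorm R * X ^ 3 * expand5 (pentagonalSeries R) ^ 15 +
      7812500 * X ^ 4 * expand5 (pentagonalSeries R) ^ 20 := by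
  have h := sec_pentagonalSeries_pow_five_mul R (r := 0) (by norm_num) (pentagonalSeries R ^ 15)
  simp only [← pow_add, ← pow_succ'] at h
  norm_num at h
  rw [h, sec_pentagonalSeries_pow_19, sec_pentagonalSeries_pow_18,
    sec_pentagonalSeries_pow_17, sec_pentagonalSeries_pow_16,
    sec_pentagonalSeries_pow_15]
  ring

theorem sec_pentagonalSeries_pow_21 :
    sec 1 (pentagonalSeries R ^ 21) = -(21 * eulerNorm R ^ 4 * expand5 (pentagonalSeries R)) -
      13825 * eulerNorm R ^ 3 * X * expand5 (pentagonalSeries R) ^ 6 -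
      196875 * eulerNorm R ^ 2 * X ^ 2 * expand5 (pentagonalSeries R) ^ 11 -
      1640625 * eulerNorm R * X ^ 3 * expand5 (pentagonalSeries R) ^ 16 -
      9765625 * X ^ 4 * expand5 (pentagonalSeries R) ^ 21 := by
  have h := sec_pentagonalSeries_pow_five_mul R (r := 1) (by norm_num) (pentagonalSeries R ^ 16)
  simp only [← pow_add, ← pow_succ'] at h
  norm_num at h
  rw [h, sec_pentagonalSeries_pow_20, sec_pentagonalSeries_pow_19,
    sec_pentagonalSeries_pow_18, sec_pentagonalSeries_pow_17,
    sec_pentagonalSeries_pow_16]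
  ring

theorem sec_pentagonalSeries_pow_22 :
    sec 2 (pentagonalSeries R ^ 22) = 209 * eulerNorm R ^ 4 * expand5 (pentagonalSeries R) ^ 2 +
      52250 * eulerNorm R ^ 3 * X * expand5 (pentagonalSeries R) ^ 7 +
      653125 * eulerNorm R ^ 2 * X ^ 2 * expand5 (pentagonalSeries R) ^ 12 -
      9765625 * X ^ 4 * expand5 (pentagonalSeries R) ^ 22 := by
  have h := sec_pentagonalSeries_pow_five_mul R (r := 2) (by norm_num) (pentagonalSeries R ^ 17)
  simp only [← pow_add, ← pow_succ'] at h
  norm_num at h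
  rw [h, sec_pentagonalSeries_pow_21, sec_pentagonalSeries_pow_20,
    sec_pentagonalSeries_pow_19, sec_pentagonalSeries_pow_18,
    sec_pentagonalSeries_pow_17]
  ring

theorem sec_pentagonalSeries_pow_23 :
    sec 3 (pentagonalSeries R ^ 23) = -(1265 * eulerNorm R ^ 4 * expand5 (pentagonalSeries R) ^ 3) -
      94875 * eulerNorm R ^ 3 * X * expand5 (pentagonalSeries R) ^ 8 -
      1437500 * eulerNorm R ^ 2 * X ^ 2 * expand5 (pentagonalSeries R) ^ 13 +
      48828125 * X ^ 4 * expand5 (pentagonalSeries R) ^ 23 := by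
  have h := sec_pentagonalSeries_pow_five_mul R (r := 3) (by norm_num) (pentagonalSeries R ^ 18)
  simp only [← pow_add, ← pow_succ'] at h
  norm_num at h
  rw [h, sec_pentagonalSeries_pow_22, sec_pentagonalSeries_pow_21,
    sec_pentagonalSeries_pow_20, sec_pentagonalSeries_pow_19,
    sec_pentagonalSeries_pow_18]
  ring

theorem sec_pentagonalSeries_pow_24 :
    sec 4 (pentagonalSeries R ^ 24) = 4830 * eulerNorm R ^ 4 * expand5 (pentagonalSeries R) ^ 4 -
      48828125 * X ^ 4 * expand5 (pentagonalSeries R) ^ 24 := by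
  have h := sec_pentagonalSeries_pow_five_mul R (r := 4) (by norm_num) (pentagonalSeries R ^ 19)
  simp only [← pow_add, ← pow_succ'] at h
  norm_num at h
  rw [h, sec_pentagonalSeries_pow_23, sec_pentagonalSeries_pow_22,
    sec_pentagonalSeries_pow_21, sec_pentagonalSeries_pow_20,
    sec_pentagonalSeries_pow_19]
  ring

variable {R} in
-- The recurrence at e = -1. Once D = P^6 / P(X^5) is known, this is Ramanujan's ∑ p(5n+4) X^n = 5
-- P(X^5)^5 / P^6.
theorem eulerNorm_mul_sec_four_inv {f : R⟦X⟧} (hf : pentagonalSeries R * f = 1) :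
    eulerNorm R * sec 4 f = 5 * expand5 (pentagonalSeries R) ^ 4 := by
  have hp (k : ℕ) : pentagonalSeries R ^ (k + 1) * f = pentagonalSeries R ^ k := by
    rw [pow_succ, mul_assoc, hf, mul_one]
  have h := sec_pentagonalSeries_pow_five_mul R (r := 4) (by norm_num) f
  rw [hp 4, hp 3, hp 2, hp 1, hf] at h
  norm_num at h
  rw [sec_zero_one, sec_one_pentagonalSeries, sec_pentagonalSeries_pow_two,
    sec_pentagonalSeries_pow_three, sec_pentagonalSeries_pow_four] at h
  linear_combination -h

variable {R} in
theorem eulerNorm_mul_sec_three_inv_sq {f : R⟦X⟧} (hf : pentagonalSeries R * f = 1) :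
    eulerNorm R * sec 3 (f ^ 2) = 10 * expand5 (pentagonalSeries R) ^ 3 +
      25 * X * expand5 (pentagonalSeries R) ^ 4 * sec 4 f := by
  have hp (k : ℕ) : pentagonalSeries R ^ (k + 2) * f ^ 2 = pentagonalSeries R ^ k := by
    rw [pow_add, mul_assoc, ← mul_pow, hf, one_pow, mul_one]
  have h1 : pentagonalSeries R * f ^ 2 = f := by rw [pow_two, ← mul_assoc, hf, one_mul]
  have h := sec_pentagonalSeries_pow_five_mul R (r := 3) (by norm_num) (f ^ 2)
  rw [hp 3, hp 2, hp 1, hp 0, h1] at h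
  norm_num at h
  rw [sec_zero_one, sec_one_pentagonalSeries, sec_pentagonalSeries_pow_two,
    sec_pentagonalSeries_pow_three] at h
  linear_combination -h

end Powers
end PowerSeries

/-! ### The Hecke relation modulo 23. -/

namespace PowerSeries

section Hecke
variable {K : Type*} [Field K]

/-- Modulo `23`, the twenty-second power of Euler's function is an eigenvector of the square of the
Hecke operator at `5`. -/
theorem sec_sec_sec_pentagonalSeries_pow [CharP K 23] {z : K} (hz : IsPrimitiveRoot z 5) :
    sec 2 (sec 4 (sec 2 (pentagonalSeries K ^ 22))) =
      4 * sec 2 (pentagonalSeries K ^ 22) + 11 * (X ^ 4 * expand5 (pentagonalSeries K ^ 22)) := by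
  obtain ⟨f, hf⟩ : ∃ f, pentagonalSeries K * f = 1 := by
    refine (isUnit_iff_constantCoeff.mpr ?_).exists_right_inv
    rw [← coeff_zero_eq_constantCoeff_apply, show 0 = pentagonal 0 by decide,
      coeff_pentagonalSeries_pentagonal]
    simp
  have hfg : expand5 (pentagonalSeries K) * expand5 f = 1 := by rw [← map_mul, hf, map_one]
  have hD := eulerNorm_mul hz
  have hi1 := eulerNorm_mul_sec_four_inv hf
  have hi2 := eulerNorm_mul_sec_three_inv_sq hf
  have h4 := sec_pentagonalSeries_pow_four K
  have h10 := sec_pentagonalSeries_pow_10 K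
  have h12 := sec_pentagonalSeries_pow_12 K
  have h18 := sec_pentagonalSeries_pow_18 K
  have h22 := sec_pentagonalSeries_pow_22 K
  have h24 := sec_pentagonalSeries_pow_24 K
  have h23 : (23 : K⟦X⟧) = 0 := by
    have : (23 : K) = 0 := by exact_mod_cast CharP.cast_eq_zero K 23
    rw [← map_ofNat (C : K →+* K⟦X⟧) 23, this, map_zero]
  set P := pentagonalSeries K
  set D := eulerNorm K
  -- With D = P^6 / P(X^5), each monomial becomes a series in X^5 times X^k P^(6i), ready for the
  -- next section.
  have F1 : sec 2 (P ^ 22) = expand5 (209 * f ^ 2) * P ^ 24 +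
      expand5 (52250 * P ^ 4) * (X ^ 1 * P ^ 18) + expand5 (653125 * P ^ 10) * (X ^ 2 * P ^ 12) -
      expand5 (9765625 * P ^ 22) * (X ^ 4 * 1) := by
    rw [h22]
    simp only [map_mul, map_pow, map_ofNat]
    rw [show P ^ 24 = (P ^ 6) ^ 4 by ring, show P ^ 18 = (P ^ 6) ^ 3 by ring,
      show P ^ 12 = (P ^ 6) ^ 2 by ring, ← hD]
    linear_combination -209 * D ^ 4 * expand5 P ^ 2 * (expand5 P * expand5 f + 1) * hfg
  have F2 : sec 4 (sec 2 (P ^ 22)) = expand5 (-134905) * P ^ 22 +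
      expand5 (-2041015625 * P ^ 12) * (X ^ 2 * P ^ 10) + expand5 (-20410156250 * P ^ 18) * (X ^ 3 * P ^ 4) +
      expand5 (-10205078125 * P ^ 24) * (X ^ 4 * f ^ 2) := by
    rw [F1, map_sub, map_add, map_add, sec_expand5_mul (by norm_num), sec_expand5_mul (by norm_num),
      sec_expand5_mul (by norm_num), sec_expand5_mul (by norm_num), sec_add_X_pow_mul 3 1,
      sec_add_X_pow_mul 2 2, sec_add_X_pow_mul 0 4, sec_zero_one, h12, h18, h24]
    simp only [map_mul, map_pow, map_ofNat, map_neg]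
    have e1 : 4830 * D ^ 4 * expand5 P ^ 4 * f ^ 2 = 4830 * P ^ 22 := by
      calc _ = 4830 * (D * expand5 P) ^ 4 * f ^ 2 := by ring
        _ = 4830 * P ^ 22 * (P * f) ^ 2 := by rw [hD]; ring
        _ = _ := by rw [hf]; ring
    linear_combination 209 * e1 - 52250 * P ^ 4 * 510 * ((D * expand5 P) ^ 2 +
      D * expand5 P * P ^ 6 + P ^ 12) * hD + 653125 * P ^ 10 * 54 * (D * expand5 P + P ^ 6) * hD
  -- Since P^24 = (D P(X^5))^4, the factors D clear the denominators of the section of P^(-2).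
  have e2 : P ^ 24 * sec 3 (f ^ 2) =
      10 * expand5 P ^ 7 * D ^ 3 + 125 * X * expand5 P ^ 12 * D ^ 2 := by
    rw [show P ^ 24 = (P ^ 6) ^ 4 by ring, ← hD]
    linear_combination expand5 P ^ 4 * D ^ 3 * hi2 + 25 * X * expand5 P ^ 8 * D ^ 2 * hi1
  rw [F2, map_add, map_add, map_add, sec_expand5_mul (by norm_num), sec_expand5_mul (by norm_num),
    sec_expand5_mul (by norm_num), sec_expand5_mul (by norm_num), sec_add_X_pow_mul 0 2,
    sec_X_pow_mul_of_lt (by norm_num) (by norm_num),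
    sec_X_pow_mul_of_lt (by norm_num) (by norm_num), show 2 + 5 - 3 = 4 from rfl,
    show 2 + 5 - 4 = 3 from rfl, h10, h4, h22, map_pow expand5 P 22]
  rw [show P ^ 12 = (P ^ 6) ^ 2 by ring, show P ^ 18 = (P ^ 6) ^ 3 by ring, ← hD]
  -- Both sides are now polynomials in D, P(X^5) and X; the multipliers of `h23` are their
  -- coefficient differences divided by 23.
  linear_combination -10205078125 * X * e2 + (-89965722 * D ^ 4 * expand5 P ^ 2 +
    -22491430500 * X * D ^ 3 * expand5 P ^ 7 + -281142881250 * X ^ 2 * D ^ 2 * expand5 P ^ 12 +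
    57281334918 * X ^ 4 * expand5 P ^ 22) * h23

end Hecke

/-! ### Regular partitions in prime characteristic. -/

section GeneratingFunction
open WithPiTopology

theorem mk_card_restricted_eq_pentagonalSeries_pow (K : Type*) [Field K] (p : ℕ) [Fact p.Prime]
    [CharP K p] :
    (mk fun n ↦ ((Nat.Partition.restricted n (fun i ↦ ¬ p ∣ i)).card : K)) =
      pentagonalSeries K ^ (p - 1) := by
  let : TopologicalSpace K := ⊥
  have : DiscreteTopology K := ⟨rfl⟩
  have : CharP K⟦X⟧ p := charP_of_injective_ringHom (C_injective (R := K)) p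
  have hp0 : p ≠ 0 := (Fact.out : p.Prime).ne_zero
  have h1 := (Nat.Partition.hasProd_powerSeriesMk_card_restricted K (fun i ↦ ¬ p ∣ i)).mul
    (hasProd_one_sub_X_pow K)
  have h2 : HasProd (fun n ↦ if p ∣ n + 1 then (1 - X ^ (n + 1) : K⟦X⟧) else 1)
      (pentagonalSeries K ^ p) := by
    refine hasProd_ite_dvd hp0 (fun n ↦ (1 - X ^ n : K⟦X⟧)) ?_
    refine ((hasProd_one_sub_X_pow K).pow p).congr_fun fun n ↦ ?_
    rw [sub_pow_char, one_pow, ← pow_mul, mul_comm]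
  have h3 := h1.unique (h2.congr_fun fun n ↦ ?_)
  · have hP : pentagonalSeries K ≠ 0 := by
      intro h
      have := coeff_pentagonalSeries_pentagonal K 0
      rw [h] at this
      simp at this
    apply mul_right_cancel₀ hP
    rw [h3, ← pow_succ, Nat.sub_add_cancel (Nat.one_le_iff_ne_zero.mpr hp0)]
  · by_cases h : p ∣ n + 1
    · simp [h]
    · simp only [h, not_false_eq_true, if_true, if_false, pow_mul]
      exact tsum_pow_mul_one_sub_of_constantCoeff_eq_zero (by simp)

end GeneratingFunction

end PowerSeries

/-! ### The linear recurrence modulo 23. -/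

section Recurrence

/-- The roots α of x^2 - 4x - 11 lie in the field of 529 elements and satisfy α^12 = 14. The
coefficients 1, 4, 27, 152, … below solve the same recurrence over the integers. -/
theorem recurrence_add_twelve {w : ℕ → ZMod 23} (hw : ∀ j, w (j + 2) = 4 * w (j + 1) + 11 * w j)
    (j : ℕ) : w (j + 12) = 14 * w j := by
  have h23 : (23 : ZMod 23) = 0 := by decide
  linear_combination 1 * hw (j + 10) + 4 * hw (j + 9) + 27 * hw (j + 8) + 152 * hw (j + 7) +
    905 * hw (j + 6) + 5292 * hw (j + 5) + 31123 * hw (j + 4) + 182704 * hw (j + 3) +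
    1073169 * hw (j + 2) + 6302420 * hw (j + 1) + 37014539 * hw j +
    (9451512 * w (j + 1) + 17702605 * w j) * h23

theorem recurrence_twelve_mul_add {w : ℕ → ZMod 23}
    (hw : ∀ j, w (j + 2) = 4 * w (j + 1) + 11 * w j) (j k : ℕ) :
    w (12 * k + j) = 14 ^ k * w j := by
  induction k with
  | zero => simp
  | succ k ih =>
    rw [show 12 * (k + 1) + j = 12 * k + j + 12 by ring, recurrence_add_twelve hw, ih]
    ring

/-- These initial values make w(j) proportional to α^(j+1) - β^(j+1) for the two roots α and β, and
α^12 = β^12. -/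
theorem recurrence_eleven {w : ℕ → ZMod 23} (hw : ∀ j, w (j + 2) = 4 * w (j + 1) + 11 * w j)
    (h1 : w 1 = 4 * w 0) : w 11 = 0 := by
  have h23 : (23 : ZMod 23) = 0 := by decide
  linear_combination 1 * hw 9 + 4 * hw 8 + 27 * hw 7 + 152 * hw 6 + 905 * hw 5 +
    5292 * hw 4 + 31123 * hw 3 + 182704 * hw 2 + 1073169 * hw 1 +
    6302420 * hw 0 + 37014539 * h1 + 9451512 * w 0 * h23

/-- The integer sequence with the recurrence of `aSeq`. -/
def aInt : ℕ → ℤ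
  | 0 => 1
  | 1 => 0
  | k + 2 => 4 * aInt (k + 1) + 11 * aInt k

theorem aSeq_add_two (k : ℕ) : aSeq (k + 2) = 4 * aSeq (k + 1) + 11 * aSeq k := by
  have hs : Real.sqrt 15 ^ 2 = 15 := Real.sq_sqrt (by norm_num)
  simp only [aSeq]
  linear_combination ((1 / 2 - Real.sqrt 15 / 15) * (2 + Real.sqrt 15) ^ k +
    (1 / 2 + Real.sqrt 15 / 15) * (2 - Real.sqrt 15) ^ k) * hs

theorem aInt_eq_aSeq (k : ℕ) : (aInt k : ℝ) = aSeq k := by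
  induction k using Nat.twoStepInduction with
  | zero => simp [aInt, aSeq]; norm_num
  | one =>
    have hs : Real.sqrt 15 ^ 2 = 15 := Real.sq_sqrt (by norm_num)
    simp only [aInt, aSeq]
    push_cast
    linear_combination 2 / 15 * hs
  | more k h0 h1 =>
    rw [aSeq_add_two, aInt, ← h0, ← h1]
    push_cast
    ring

end Recurrence

/-! ### Orbits of m ↦ 25m + 22. -/

section RegularPartitions

instance fact_prime_twenty_three : Fact (Nat.Prime 23) := ⟨by norm_num⟩

/-- The prime field is too small: 5 does not divide 22. -/
theorem exists_primitiveRoot_algebraicClosure :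
    ∃ z : AlgebraicClosure (ZMod 23), IsPrimitiveRoot z 5 := by
  have : NeZero ((5 : ℕ) : AlgebraicClosure (ZMod 23)) := by
    refine ⟨fun h ↦ ?_⟩
    rw [CharP.cast_eq_zero_iff (AlgebraicClosure (ZMod 23)) 23] at h
    omega
  exact HasEnoughRootsOfUnity.exists_primitiveRoot (AlgebraicClosure (ZMod 23)) 5

theorem algebraMap_regularPartitionCount (n : ℕ) :
    algebraMap (ZMod 23) (AlgebraicClosure (ZMod 23)) (regularPartitionCount 23 n) =
      coeff n (pentagonalSeries (AlgebraicClosure (ZMod 23)) ^ 22) := by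
  rw [show 22 = 23 - 1 from rfl, ← mk_card_restricted_eq_pentagonalSeries_pow _ 23, coeff_mk,
    map_natCast, regularPartitionCount]

theorem regularPartitionCount_hecke (n : ℕ) :
    (regularPartitionCount 23 (25 * (5 * n + 2) + 22) : ZMod 23) =
      4 * regularPartitionCount 23 (5 * n + 2) +
        if n % 5 = 4 then 11 * (regularPartitionCount 23 (n / 5) : ZMod 23) else 0 := by
  obtain ⟨z, hz⟩ := exists_primitiveRoot_algebraicClosure
  have h := congrArg (coeff n) (sec_sec_sec_pentagonalSeries_pow hz)
  rw [coeff_sec, coeff_sec, coeff_sec, map_add,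
    show (4 : (AlgebraicClosure (ZMod 23))⟦X⟧) = C 4 from (map_ofNat C 4).symm,
    show (11 : (AlgebraicClosure (ZMod 23))⟦X⟧) = C 11 from (map_ofNat C 11).symm,
    coeff_C_mul, coeff_C_mul, coeff_sec, coeff_X_pow_mul', coeff_expand,
    ← algebraMap_regularPartitionCount, ← algebraMap_regularPartitionCount] at h
  apply (algebraMap (ZMod 23) (AlgebraicClosure (ZMod 23))).injective
  have e4 : algebraMap (ZMod 23) (AlgebraicClosure (ZMod 23)) 4 = 4 := map_ofNat _ 4
  have e11 : algebraMap (ZMod 23) (AlgebraicClosure (ZMod 23)) 11 = 11 := map_ofNat _ 11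
  rw [show 25 * (5 * n + 2) + 22 = 5 * (5 * (5 * n + 2) + 4) + 2 by ring, h, map_add, map_mul, e4]
  split_ifs with h1 h2 h3 h3
  · rw [← algebraMap_regularPartitionCount, show (n - 4) / 5 = n / 5 by omega, map_mul, e11]
  · omega
  · omega
  · rw [map_zero, mul_zero]
  · omega
  · rw [map_zero, mul_zero]

/-- The index x at time j satisfies 12x + 11 = 25^j (12n + 11), so the truncated division is exact.
-/
theorem orbit_succ (n j : ℕ) :
    25 ^ (j + 1) * n + 11 * (25 ^ (j + 1) - 1) / 12 =
      25 * (25 ^ j * n + 11 * (25 ^ j - 1) / 12) + 22 := by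
  obtain ⟨t, ht⟩ : ∃ t, 25 ^ j = 12 * t + 1 := by
    induction j with
    | zero => exact ⟨0, rfl⟩
    | succ j ih =>
      obtain ⟨t, ht⟩ := ih
      exact ⟨25 * t + 2, by rw [pow_succ, ht]; ring⟩
  have h1 : 11 * (25 ^ (j + 1) - 1) / 12 = 25 * (11 * (25 ^ j - 1) / 12) + 22 := by
    rw [pow_succ]
    omega
  rw [h1, pow_succ]
  ring

theorem regularPartitionCount_orbit_recurrence (n j : ℕ) :
    (regularPartitionCount 23 (25 ^ (j + 2) * n + 11 * (25 ^ (j + 2) - 1) / 12) : ZMod 23) =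
      4 * regularPartitionCount 23 (25 ^ (j + 1) * n + 11 * (25 ^ (j + 1) - 1) / 12) +
        11 * regularPartitionCount 23 (25 ^ j * n + 11 * (25 ^ j - 1) / 12) := by
  rw [orbit_succ n (j + 1), orbit_succ n j]
  generalize 25 ^ j * n + 11 * (25 ^ j - 1) / 12 = m
  -- After one step every orbit lies in 22 mod 25, so the 11-term is present.
  have h := regularPartitionCount_hecke (5 * m + 4)
  rw [if_pos (by omega), show (5 * m + 4) / 5 = m by omega] at h
  rw [show 25 * m + 22 = 5 * (5 * m + 4) + 2 by ring, h]

/-- The residues modulo `23` along the orbit of `n` under `n ↦ 25 * n + 22`. -/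
def orbitResidue (n j : ℕ) : ZMod 23 :=
  regularPartitionCount 23 (25 ^ j * n + 11 * (25 ^ j - 1) / 12)

theorem orbitResidue_add_two (n j : ℕ) :
    orbitResidue n (j + 2) = 4 * orbitResidue n (j + 1) + 11 * orbitResidue n j :=
  regularPartitionCount_orbit_recurrence n j

theorem orbitResidue_zero (n : ℕ) : orbitResidue n 0 = regularPartitionCount 23 n := by
  simp [orbitResidue]

theorem orbitResidue_one (n : ℕ) : orbitResidue n 1 = regularPartitionCount 23 (25 * n + 22) := by
  simp [orbitResidue]

theorem regularPartitionCount_orbit_twelve_mul (n k : ℕ) :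
    (regularPartitionCount 23 (25 ^ (12 * k) * n + 11 * (25 ^ (12 * k) - 1) / 12) : ZMod 23) =
      14 ^ k * regularPartitionCount 23 n := by
  have h := recurrence_twelve_mul_add (orbitResidue_add_two n) 0 k
  rwa [orbitResidue_zero] at h

theorem regularPartitionCount_orbit_twelve_mul_add_eleven {m : ℕ} (hm : m % 5 ≠ 4) (k : ℕ) :
    (regularPartitionCount 23
      (25 ^ (12 * k + 11) * (5 * m + 2) + 11 * (25 ^ (12 * k + 11) - 1) / 12) : ZMod 23) = 0 := by
  have h := regularPartitionCount_hecke m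
  -- The missing 11-term is the initial condition w(1) = 4w(0).
  rw [if_neg hm, add_zero, ← orbitResidue_one, ← orbitResidue_zero (5 * m + 2)] at h
  have h2 := recurrence_twelve_mul_add (orbitResidue_add_two (5 * m + 2)) 11 k
  rwa [recurrence_eleven (orbitResidue_add_two (5 * m + 2)) h, mul_zero] at h2

end RegularPartitions

/-! ### The two congruences. -/

theorem theorem3 :
    (∃ a : ℕ → ℤ, (∀ k : ℕ, (a k : ℝ) = aSeq k) ∧
      (∀ k : ℕ, 1 ≤ k → a (k + 1) = 4 * a k + 11 * a (k - 1)) ∧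
      ∀ n k : ℕ,
        (regularPartitionCount 23 (5 ^ (24 * k) * n + 11 * (5 ^ (24 * k) - 1) / 12) : ℤ) ≡
          a (12 * k) * (regularPartitionCount 23 n : ℤ) [ZMOD 23]) ∧
    ∀ n k r : ℕ, r ∈ ({0, 1, 2, 3} : Set ℕ) →
      regularPartitionCount 23
        (5 ^ (24 * k + 24) * n + (5 ^ (24 * k + 23) * (12 * r + 7) - 11) / 12) ≡ 0 [MOD 23] := by
  refine ⟨⟨aInt, aInt_eq_aSeq, fun k hk ↦ ?_, fun n k ↦ ?_⟩, fun n k r hr ↦ ?_⟩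
  · obtain ⟨k, rfl⟩ := Nat.exists_eq_add_of_le' hk
    rfl
  · have ha : ((aInt (12 * k) : ℤ) : ZMod 23) = 14 ^ k := by
      have hw (j : ℕ) : ((aInt (j + 2) : ℤ) : ZMod 23) =
          4 * ((aInt (j + 1) : ℤ) : ZMod 23) + 11 * ((aInt j : ℤ) : ZMod 23) := by
        rw [aInt]
        push_cast
        rfl
      simpa [aInt] using recurrence_twelve_mul_add (w := fun j ↦ ((aInt j : ℤ) : ZMod 23)) hw 0 k
    have h := regularPartitionCount_orbit_twelve_mul n k
    rw [← ha, show 25 = 5 ^ 2 from rfl, ← pow_mul, ← mul_assoc] at h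
    refine (ZMod.intCast_eq_intCast_iff _ _ 23).mp ?_
    push_cast
    exact h
  · have hr' : r < 4 := by
      rcases hr with rfl | rfl | rfl | rfl <;> norm_num
    have h := regularPartitionCount_orbit_twelve_mul_add_eleven (m := 5 * n + r) (by omega) k
    -- With m = 5n + r, both sides are the x with 12x + 11 = 25^(12k+11) · 5(12m + 7): the orbit of
    -- 5m + 2 at time 12k + 11.
    have he : 5 ^ (24 * k + 24) * n + (5 ^ (24 * k + 23) * (12 * r + 7) - 11) / 12 =
        25 ^ (12 * k + 11) * (5 * (5 * n + r) + 2) + 11 * (25 ^ (12 * k + 11) - 1) / 12 := by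
      obtain ⟨t, ht⟩ : ∃ t, 25 ^ (12 * k + 11) = 12 * t + 1 := by
        have : 25 ^ (12 * k + 11) % 12 = 1 := by simp [Nat.pow_mod]
        exact ⟨25 ^ (12 * k + 11) / 12, by omega⟩
      have h5 : 5 ^ (24 * k + 22) = 12 * t + 1 := by
        rw [← ht, show 25 = 5 ^ 2 from rfl, ← pow_mul]
        ring_nf
      have h6 : 5 ^ (24 * k + 23) = 5 * (12 * t + 1) := by rw [← h5]; ring
      have h7 : 5 ^ (24 * k + 24) = 25 * (12 * t + 1) := by rw [← h5]; ring
      rw [h6, h7, ht,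
        show 5 * (12 * t + 1) * (12 * r + 7) - 11 = 12 * (5 * (12 * t + 1) * r + 35 * t + 2) by
          rw [Nat.sub_eq_iff_eq_add (by nlinarith)]; ring,
        Nat.mul_div_cancel_left _ (by norm_num), Nat.add_sub_cancel,
        show 11 * (12 * t) = 12 * (11 * t) by ring, Nat.mul_div_cancel_left _ (by norm_num)]
      ring
    rw [he]
    exact (ZMod.natCast_eq_natCast_iff _ _ 23).mp (by exact_mod_cast h)
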